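/- Let $K$ be a field and let $F\in K[[x]][y]$ be a Weierstrass polynomial of degree $d$ in $y$, i.e. $F=y^d+\sum_{i<d}a_i(x)y^i$ with $a_i(0)=0$ for all $i<d$. Assume that the characteristic of $K$ does not divide $d$. Then Abhyankar's test described below, applied to $F$, terminates and returns True if and only if $F$ is irreducible in $\overline K[[x]][y]$, where $\overline K$ is an algebraic closure of $K$ (and it returns False otherwise). *Notions used.* For $N\mid d$, the $N$-th approximate root of $F$ is the unique monic $\psi\in K[[x]][y]$ of degree $d/N$ with $\deg(F-\psi^N)<d-d/N$. For a monic non-constant $\psi$, every $G\in K[[x]][y]$ has a unique $\psi$-adic expansion $G=\sum_i c_i\psi^i$ with $\deg c_i<\deg\psi$. Put $v_0\big(\sum_i g_i(x)y^i\big)=\min_i\mathrm{val}_x(g_i)$. Given a map $v_k$, the polynomial $\psi_k$ and the expansion $F=\sum_i c_i\psi_k^i$, the polygon $\mathcal N_k(F)$ is the union of the edges of strictly negative finite slope of $$\mathrm{Conv}\Big(\bigcup_{c_i\neq0}\big((i,v_k(c_i\psi_k^i))+(\mathbb R^+)^2\big)\Big)$$ (or its unique vertex, if there is no such edge). It is called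 straight if it is a single point or a single segment with an end point on the vertical axis $\{0\}\times\mathbb R$ (if $c_0=\dots=c_{i-1}=0$, the points with abscissa less than $i$ lie at infinite height, and the polygon then has an additional edge of infinite slope). A straight polygon has slope $-m/q$ with $m\ge0$, $q\geq1$ coprime integers; by convention $(m,q)=(0,1)$ for a single point. *The test.* Start with $N=d$, $k=0$ and $v_0$. While $N>1$: let $\psi_k$ be the $N$-th approximate root of $F$ and compute $\mathcal N_k(F)$. If $(N,v_k(F))\notin\mathcal N_k(F)$, or $\mathcal N_k(F)$ is not straight, or $q=1$, where $-m/q$ is the slope of $\mathcal N_k(F)$, then return False. Otherwise define $v_{k+1}$ by $$v_{k+1}(G)=\min_i\big(q\,v_k(a_i\psi_k^i)+i\,m\big)\quad\text{for } G=\sum_i a_i\psi_k^i \text{ (the $\psi_k$-adic expansion)},$$ replace $N$ by $N/q$ and $k$ by $k+1$, and continue. When $N\le1$, return True. -/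

import Mathlib

open scoped Polynomial PowerSeries

noncomputable section

namespace Abhyankar

variable {K : Type*} [Field K]

/-- `ψ` is an `N`-th approximate root of the monic polynomial `F` of degree `d` (with `N ∣ d`):
it is monic of degree `d / N` and `deg (F - ψ ^ N) < d - d / N`. -/
def IsApproxRoot (F : K⟦X⟧[X]) (N : ℕ) (ψ : K⟦X⟧[X]) : Prop :=
  ψ.Monic ∧ ψ.natDegree = F.natDegree / N ∧
    (F - ψ ^ N).degree < ((F.natDegree - F.natDegree / N : ℕ) : WithBot ℕ)

open Classical in
/-- The `N`-th approximate root of `F` (it exists and is unique when `F` is monic, `N ∣ deg F` and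
the characteristic of `K` does not divide `deg F`). -/
def approxRoot (F : K⟦X⟧[X]) (N : ℕ) : K⟦X⟧[X] :=
  if h : ∃ ψ, IsApproxRoot F N ψ then h.choose else 0

/-- The `i`-th coefficient `c_i` of the `ψ`-adic expansion `G = ∑ c_i ψ ^ i`, `deg c_i < deg ψ`,
with respect to a monic nonconstant polynomial `ψ`. -/
def adicCoeff (ψ G : K⟦X⟧[X]) (i : ℕ) : K⟦X⟧[X] :=
  (G /ₘ ψ ^ i) %ₘ ψ

/-- The initial valuation: the `x`-adic valuation of a polynomial in `y` over `K[[x]]`, that is the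
minimum of the `x`-orders of its coefficients (`⊤` for the zero polynomial). -/
def initialVal (G : K⟦X⟧[X]) : ℕ∞ :=
  ⨅ i : ℕ, (G.coeff i).order

/-- The next valuation: `G = ∑ a_i ψ ^ i` is sent to `min_i (q * v (a_i ψ ^ i) + i * m)`. -/
def nextVal (v : K⟦X⟧[X] → ℕ∞) (ψ : K⟦X⟧[X]) (q m : ℕ) (G : K⟦X⟧[X]) : ℕ∞ :=
  ⨅ i : ℕ, ((q : ℕ∞) * v (adicCoeff ψ G i * ψ ^ i) + (i : ℕ∞) * (m : ℕ∞))

/-- The convex hull of the union of the translated quadrants `(i, v (c_i ψ ^ i)) + (ℝ⁺)²`, `c_i ≠ 0`,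
where `F = ∑ c_i ψ ^ i` is the `ψ`-adic expansion. -/
def newtonRegion (v : K⟦X⟧[X] → ℕ∞) (ψ F : K⟦X⟧[X]) : Set (ℝ × ℝ) :=
  convexHull ℝ {p : ℝ × ℝ | ∃ i n : ℕ, adicCoeff ψ F i ≠ 0 ∧
    v (adicCoeff ψ F i * ψ ^ i) = (n : ℕ∞) ∧ (i : ℝ) ≤ p.1 ∧ (n : ℝ) ≤ p.2}

/-- The Newton polygon: the union of the edges of strictly negative (finite) slope of the boundary
of the Newton region, or its only vertex if there is no such edge. These are exactly the minimal
points of the region for the product order of `ℝ × ℝ`. -/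
def newtonPolygon (v : K⟦X⟧[X] → ℕ∞) (ψ F : K⟦X⟧[X]) : Set (ℝ × ℝ) :=
  {p | Minimal (fun p' => p' ∈ newtonRegion v ψ F) p}

/-- A Newton polygon is straight if it is a single point or a single segment starting on the vertical
axis. (If the coefficients `c_0, …, c_{i-1}` vanish, the points of abscissa `0, …, i-1` lie at infinite
height, and the polygon has an edge of infinite slope besides its edges of finite slope.) -/
def IsStraight (P : Set (ℝ × ℝ)) : Prop :=
  (∃ p, P = {p}) ∨ ∃ (a : ℝ) (p : ℝ × ℝ), P = segment ℝ (0, a) p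

/-- `μ` is the opposite of the slope of a line joining two points of `P` of distinct abscissas. -/
def HasNegSlope (P : Set (ℝ × ℝ)) (μ : ℚ) : Prop :=
  ∃ p ∈ P, ∃ p' ∈ P, p.1 < p'.1 ∧ p.2 - p'.2 = (μ : ℝ) * (p'.1 - p.1)

open Classical in
/-- The rational number `m / q` such that the straight polygon `P` has slope `-m / q`
(`0 = 0 / 1` if `P` is a single point). -/
def negSlope (P : Set (ℝ × ℝ)) : ℚ :=
  if h : ∃ μ : ℚ, HasNegSlope P μ then h.choose else 0

open Classical in
/-- The loop of Abhyankar's test, run from the current integer `N` and the current valuation `v`. -/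
def testLoop (F : K⟦X⟧[X]) (N : ℕ) (v : K⟦X⟧[X] → ℕ∞) : Bool :=
  if hN : 1 < N then
    let ψ := approxRoot F N
    let P := newtonPolygon v ψ F
    let q := (negSlope P).den
    let m := (negSlope P).num.toNat
    if hP : (∃ n : ℕ, v F = (n : ℕ∞) ∧ ((N : ℝ), (n : ℝ)) ∈ P) ∧ IsStraight P ∧ 1 < q then
      testLoop F (N / q) (nextVal v ψ q m)
    else false
  else true
termination_by N
decreasing_by exact Nat.div_lt_self (by omega) hP.2.2

/-- Abhyankar's absolute irreducibility test. -/
def abhyankarTest (F : K⟦X⟧[X]) : Bool :=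
  testLoop F F.natDegree initialVal

end Abhyankar

end

open scoped Polynomial PowerSeries

noncomputable section

namespace Abhyankar

variable {K : Type*} [Field K]

/-! ### The Gauss valuation -/

/-! The test only handles data defined over `K`, and approximate roots commute with extension of the
field by uniqueness, so `K` may be taken algebraically closed (`abhyankarTest_map`). A monic
irreducible polynomial of degree n prime to the characteristic then has a root α(t) with t^n = x,
and its roots are the n conjugates α(ω^j t) (`exists_puiseux`).

Let b be 0 or a characteristic exponent of α, that is, one at which the gcd N of n and the exponents
up to b drops, and let n = N e. The valuation v of the test is identified by N v(G) = ord_t G(t^n, α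
+ t^b y), and for deg G < e this is just ord_t G(t^n, α) (`IsState`). Let b' be the next
characteristic exponent. A monic ψ of degree e with the right orders is a key polynomial (`IsKey`):
the minimum over the ψ-adic expansion computes the valuation attached to b'
(`IsKey.shiftVal_eq_iInf`), and the identification passes from b to b' (`IsState.next`).

Irreducible implies True (`testLoop_eq_true`). The minimal polynomial of α truncated below b' is a
key polynomial (`exists_keyPoly`). The Tschirnhausen transforms leading from it to the approximate
root only add terms of order too large to matter, so the approximate root is a key polynomial too.
Counting contact orders between conjugates shows that the polygon is the segment from (0, b' + R) to
(N, b + R); its q exceeds 1 because N does not divide b'.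

True implies irreducible (`natDegree_dvd_of_testLoop`). Some irreducible factor P of F has degree n
prime to the characteristic; let α be a root of P. In each successful round, the vanishing of F at α
forces the order of ψ at α to be the one read off the slope (`mul_evalOrd_eq_of_line`). As q > 1, it
is not a multiple of n / e, which makes ψ a key polynomial (`IsState.exists_isKey`), and e becomes q
e. At the end e = deg F divides n = deg P, so F = P. -/

theorem natCast_le_order_iff {f : K⟦X⟧} {m : ℕ} :
    (m : ℕ∞) ≤ f.order ↔ (PowerSeries.X : K⟦X⟧) ^ m ∣ f := by
  rw [PowerSeries.order_eq_emultiplicity_X, pow_dvd_iff_le_emultiplicity]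

theorem natCast_le_initialVal_iff {G : K⟦X⟧[X]} {m : ℕ} :
    (m : ℕ∞) ≤ initialVal G ↔ (Polynomial.C (PowerSeries.X : K⟦X⟧)) ^ m ∣ G := by
  rw [← Polynomial.C_pow, Polynomial.C_dvd_iff_dvd_coeff, initialVal, le_iInf_iff]
  simp only [natCast_le_order_iff]

theorem initialVal_eq_emultiplicity (G : K⟦X⟧[X]) :
    initialVal G = emultiplicity (Polynomial.C (PowerSeries.X : K⟦X⟧)) G := by
  refine ENat.eq_of_forall_natCast_le_iff fun m => ?_
  rw [natCast_le_initialVal_iff, pow_dvd_iff_le_emultiplicity]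

theorem prime_C_X : Prime (Polynomial.C (PowerSeries.X : K⟦X⟧)) :=
  Polynomial.prime_C_iff.2 PowerSeries.X_prime

/-- Gauss's lemma: x stays prime in K[[x]][y], so its multiplicity is additive. -/
theorem initialVal_mul (G H : K⟦X⟧[X]) :
    initialVal (G * H) = initialVal G + initialVal H := by
  simp only [initialVal_eq_emultiplicity]
  exact emultiplicity_mul prime_C_X

theorem initialVal_one : initialVal (1 : K⟦X⟧[X]) = 0 := by
  rw [initialVal_eq_emultiplicity]
  exact emultiplicity_of_one_right prime_C_X.not_isUnit

theorem initialVal_pow (G : K⟦X⟧[X]) (k : ℕ) :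
    initialVal (G ^ k) = k * initialVal G := by
  induction k with
  | zero => simp [initialVal_one]
  | succ k ih => rw [pow_succ, initialVal_mul, ih]; push_cast; ring

theorem initialVal_prod {ι : Type*} (s : Finset ι) (G : ι → K⟦X⟧[X]) :
    initialVal (∏ i ∈ s, G i) = ∑ i ∈ s, initialVal (G i) := by
  classical
  induction s using Finset.induction_on with
  | empty => simp [initialVal_one]
  | insert a s ha ih => rw [Finset.prod_insert ha, Finset.sum_insert ha, initialVal_mul, ih]

theorem min_le_initialVal_add (G H : K⟦X⟧[X]) :
    min (initialVal G) (initialVal H) ≤ initialVal (G + H) := by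
  simp only [initialVal_eq_emultiplicity]
  exact min_le_emultiplicity_add

theorem initialVal_zero : initialVal (0 : K⟦X⟧[X]) = ⊤ := by
  simp [initialVal]

theorem initialVal_add_eq_left {G H : K⟦X⟧[X]} (h : initialVal G < initialVal H) :
    initialVal (G + H) = initialVal G := by
  simp only [initialVal_eq_emultiplicity] at h ⊢
  rw [add_comm]
  exact emultiplicity_add_of_gt h

/-- A ring homomorphism fixing x carries divisibility by x^m to the image. -/
theorem initialVal_le_of_dvd {G H : K⟦X⟧[X]} (φ : K⟦X⟧[X] →+* K⟦X⟧[X])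
    (hφ : φ (Polynomial.C PowerSeries.X) = Polynomial.C PowerSeries.X) (h : φ G = H) :
    initialVal G ≤ initialVal H := by
  refine ENat.forall_natCast_le_iff_le.1 fun m hm => ?_
  rw [natCast_le_initialVal_iff] at hm ⊢
  rw [← h, ← hφ, ← map_pow]
  exact map_dvd φ hm

theorem initialVal_le_order_eval (G : K⟦X⟧[X]) (c : K⟦X⟧) :
    initialVal G ≤ (G.eval c).order := by
  refine ENat.forall_natCast_le_iff_le.1 fun m hm => ?_
  rw [natCast_le_initialVal_iff, ← Polynomial.C_pow] at hm
  rw [natCast_le_order_iff]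
  obtain ⟨H, rfl⟩ := hm
  simp

/-- Applied to a linear factor y - β after y ↦ α + t^c y: it contributes the contact order of α and
β, capped at c. -/
theorem initialVal_C_add_C_mul_X (c d : K⟦X⟧) :
    initialVal (Polynomial.C c + Polynomial.C d * Polynomial.X) = min c.order d.order := by
  refine ENat.eq_of_forall_natCast_le_iff fun m => ?_
  rw [initialVal, le_iInf_iff, le_min_iff]
  constructor
  · intro h
    have h0 := h 0
    have h1 := h 1
    simp [Polynomial.coeff_C] at h0 h1
    exact ⟨h0, h1⟩
  · rintro ⟨h0, h1⟩ (_ | _ | i)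
    · simpa using h0
    · simpa [Polynomial.coeff_C] using h1
    · simp [Polynomial.coeff_C_succ]

theorem initialVal_map_expand (n : ℕ) (hn : n ≠ 0) (G : K⟦X⟧[X]) :
    initialVal (G.map (PowerSeries.expand n hn : K⟦X⟧ →ₐ[K] K⟦X⟧).toRingHom) =
      n * initialVal G := by
  simp only [initialVal, Polynomial.coeff_map, AlgHom.toRingHom_eq_coe, RingHom.coe_coe,
    PowerSeries.order_expand, nsmul_eq_mul]
  exact (ENat.mul_iInf_of_ne (by simpa using hn)).symm

/-! ### Substitutions -/

/-- The substitution `x ↦ t ^ n` as a ring homomorphism. -/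
def expandHom (n : ℕ) (hn : n ≠ 0) : K⟦X⟧ →+* K⟦X⟧ :=
  (PowerSeries.expand n hn : K⟦X⟧ →ₐ[K] K⟦X⟧).toRingHom

theorem coeff_expandHom (n : ℕ) (hn : n ≠ 0) (f : K⟦X⟧) (i : ℕ) :
    PowerSeries.coeff i (expandHom n hn f) =
      if n ∣ i then PowerSeries.coeff (i / n) f else 0 :=
  PowerSeries.coeff_expand n hn f

theorem order_expandHom (n : ℕ) (hn : n ≠ 0) (f : K⟦X⟧) :
    (expandHom n hn f).order = n * f.order :=
  (PowerSeries.order_expand n hn f).trans (nsmul_eq_mul _ _)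

theorem expandHom_injective (n : ℕ) (hn : n ≠ 0) :
    Function.Injective (expandHom (K := K) n hn) := by
  intro f g h
  ext i
  have := congrArg (PowerSeries.coeff (n * i)) h
  simpa [coeff_expandHom, Nat.mul_div_cancel_left i (Nat.pos_of_ne_zero hn)] using this

/-- The substitution `x ↦ t ^ n`, `y ↦ γ`. -/
def evalHom (n : ℕ) (hn : n ≠ 0) (γ : K⟦X⟧) : K⟦X⟧[X] →+* K⟦X⟧ :=
  Polynomial.eval₂RingHom (expandHom n hn) γ

/-- The substitution `x ↦ t ^ n`, `y ↦ α + t ^ b * y`. -/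
def shiftHom (n : ℕ) (hn : n ≠ 0) (α : K⟦X⟧) (b : ℕ) : K⟦X⟧[X] →+* K⟦X⟧[X] :=
  Polynomial.eval₂RingHom (Polynomial.C.comp (expandHom n hn))
    (Polynomial.C α + Polynomial.C (PowerSeries.X ^ b) * Polynomial.X)

/-- The order of `G(t ^ n, γ)`. -/
def evalOrd (n : ℕ) (hn : n ≠ 0) (γ : K⟦X⟧) (G : K⟦X⟧[X]) : ℕ∞ :=
  (evalHom n hn γ G).order

/-- The order in `t` of `G(t ^ n, α + t ^ b * y)`. -/
def shiftVal (n : ℕ) (hn : n ≠ 0) (α : K⟦X⟧) (b : ℕ) (G : K⟦X⟧[X]) : ℕ∞ :=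
  initialVal (shiftHom n hn α b G)

variable {n : ℕ} {hn : n ≠ 0} {α γ : K⟦X⟧} {b b' : ℕ}

theorem evalHom_C (c : K⟦X⟧) : evalHom n hn γ (Polynomial.C c) = expandHom n hn c := by
  simp [evalHom]

theorem evalHom_X : evalHom n hn γ Polynomial.X = γ := by
  simp [evalHom]

theorem evalHom_eq_eval_map (G : K⟦X⟧[X]) :
    evalHom n hn γ G = (G.map (expandHom n hn)).eval γ := by
  simp [evalHom, Polynomial.eval_map]

theorem evalOrd_mul (G H : K⟦X⟧[X]) :
    evalOrd n hn γ (G * H) = evalOrd n hn γ G + evalOrd n hn γ H := by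
  simp [evalOrd, PowerSeries.order_mul]

theorem evalOrd_pow (G : K⟦X⟧[X]) (k : ℕ) :
    evalOrd n hn γ (G ^ k) = k * evalOrd n hn γ G := by
  simp [evalOrd, PowerSeries.order_pow]

theorem evalOrd_zero : evalOrd n hn γ 0 = ⊤ := by simp [evalOrd]

theorem min_le_evalOrd_add (G H : K⟦X⟧[X]) :
    min (evalOrd n hn γ G) (evalOrd n hn γ H) ≤ evalOrd n hn γ (G + H) := by
  simpa [evalOrd] using PowerSeries.min_order_le_order_add _ _

theorem evalOrd_add_eq_left {G H : K⟦X⟧[X]} (h : evalOrd n hn γ G < evalOrd n hn γ H) :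
    evalOrd n hn γ (G + H) = evalOrd n hn γ G := by
  simp only [evalOrd, map_add] at h ⊢
  rw [PowerSeries.order_add_of_order_ne _ _ h.ne, min_eq_left h.le]

theorem shiftVal_mul (G H : K⟦X⟧[X]) :
    shiftVal n hn α b (G * H) = shiftVal n hn α b G + shiftVal n hn α b H := by
  simp [shiftVal, initialVal_mul]

theorem shiftVal_pow (G : K⟦X⟧[X]) (k : ℕ) :
    shiftVal n hn α b (G ^ k) = k * shiftVal n hn α b G := by
  simp [shiftVal, initialVal_pow]

theorem shiftVal_zero : shiftVal n hn α b 0 = ⊤ := by simp [shiftVal, initialVal_zero]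

theorem min_le_shiftVal_add (G H : K⟦X⟧[X]) :
    min (shiftVal n hn α b G) (shiftVal n hn α b H) ≤ shiftVal n hn α b (G + H) := by
  simpa [shiftVal] using min_le_initialVal_add _ _

theorem shiftVal_add_eq_left {G H : K⟦X⟧[X]} (h : shiftVal n hn α b G < shiftVal n hn α b H) :
    shiftVal n hn α b (G + H) = shiftVal n hn α b G := by
  simp only [shiftVal, map_add] at h ⊢
  exact initialVal_add_eq_left h

theorem eval_shiftHom (c : K⟦X⟧) (G : K⟦X⟧[X]) :
    (shiftHom n hn α b G).eval c = evalHom n hn (α + PowerSeries.X ^ b * c) G := by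
  have : (Polynomial.evalRingHom c).comp (shiftHom n hn α b) =
      evalHom n hn (α + PowerSeries.X ^ b * c) := by
    apply Polynomial.ringHom_ext
    · intro a; simp [shiftHom, evalHom]
    · simp [shiftHom, evalHom]
  exact congrArg (fun φ => φ G) this

theorem shiftHom_comp (c : ℕ) (G : K⟦X⟧[X]) :
    (shiftHom n hn α b G).eval₂ Polynomial.C
      (Polynomial.C (PowerSeries.X ^ c) * Polynomial.X) = shiftHom n hn α (b + c) G := by
  have : (Polynomial.eval₂RingHom Polynomial.C
      (Polynomial.C (PowerSeries.X ^ c) * Polynomial.X)).comp (shiftHom n hn α b) =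
      shiftHom n hn α (b + c) := by
    apply Polynomial.ringHom_ext
    · intro a; simp [shiftHom]
    · simp only [shiftHom, RingHom.comp_apply, Polynomial.coe_eval₂RingHom, Polynomial.eval₂_X,
        Polynomial.eval₂_add, Polynomial.eval₂_mul, Polynomial.eval₂_C, pow_add, Polynomial.C_mul,
        mul_assoc]
  exact congrArg (fun φ => φ G) this

theorem shiftVal_mono (h : b ≤ b') (G : K⟦X⟧[X]) :
    shiftVal n hn α b G ≤ shiftVal n hn α b' G := by
  obtain ⟨c, rfl⟩ := Nat.exists_eq_add_of_le h
  exact initialVal_le_of_dvd (Polynomial.eval₂RingHom Polynomial.C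
    (Polynomial.C (PowerSeries.X ^ c) * Polynomial.X)) (by simp) (shiftHom_comp c G)

theorem shiftVal_le_evalOrd (h : PowerSeries.X ^ b ∣ γ - α) (G : K⟦X⟧[X]) :
    shiftVal n hn α b G ≤ evalOrd n hn γ G := by
  obtain ⟨c, hc⟩ := h
  have : γ = α + PowerSeries.X ^ b * c := by rw [← hc]; ring
  rw [evalOrd, this, ← eval_shiftHom]
  exact initialVal_le_order_eval _ _

theorem shiftVal_le_evalOrd_self (G : K⟦X⟧[X]) :
    shiftVal n hn α b G ≤ evalOrd n hn α G :=
  shiftVal_le_evalOrd (by simp) G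

/-- If `G(t ^ n, α + t ^ b * y)` has its initial form constant in `y`, then the order of
`G(t ^ n, γ)` does not depend on `γ` close to `α`. -/
theorem evalOrd_eq_of_shiftVal_eq {G : K⟦X⟧[X]}
    (hG : shiftVal n hn α b G = evalOrd n hn α G) (h : PowerSeries.X ^ (b + 1) ∣ γ - α) :
    evalOrd n hn γ G = evalOrd n hn α G := by
  obtain ⟨c, hc⟩ := h
  have hγ : γ = α + PowerSeries.X ^ b * (PowerSeries.X * c) := by
    rw [← mul_assoc, ← pow_succ, ← hc]; ring
  have hα : evalHom n hn α G = (shiftHom n hn α b G).eval 0 := by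
    rw [eval_shiftHom]; simp
  have hγ' : evalHom n hn γ G = (shiftHom n hn α b G).eval (PowerSeries.X * c) := by
    rw [eval_shiftHom, ← hγ]
  by_cases h0 : shiftVal n hn α b G = ⊤
  · have := shiftVal_le_evalOrd (n := n) (hn := hn) (b := b) (γ := γ) (α := α)
      ⟨PowerSeries.X * c, by rw [hγ]; ring⟩ G
    rw [← hG, h0]
    rw [h0] at this
    exact top_le_iff.1 this
  · obtain ⟨m, hm⟩ := ENat.ne_top_iff_exists.1 h0
    have hdvd := (natCast_le_initialVal_iff (G := shiftHom n hn α b G) (m := m)).1 hm.le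
    obtain ⟨H, hH⟩ := hdvd
    -- Once t^m is factored out, replacing y = 0 by a multiple of t alters the value by a multiple
    -- of t only, so the leading term survives.
    have h1 : evalHom n hn γ G - evalHom n hn α G =
        PowerSeries.X ^ m * (H.eval (PowerSeries.X * c) - H.eval 0) := by
      rw [hα, hγ', hH]; simp; ring
    have h2 : (PowerSeries.X : K⟦X⟧) ∣ H.eval (PowerSeries.X * c) - H.eval 0 :=
      (Dvd.intro c (by ring)).trans (Polynomial.sub_dvd_eval_sub (PowerSeries.X * c) 0 H)
    have h3 : ((m + 1 : ℕ) : ℕ∞) ≤ (evalHom n hn γ G - evalHom n hn α G).order := by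
      rw [natCast_le_order_iff, h1, pow_succ]
      exact mul_dvd_mul_left _ h2
    have h4 : (evalHom n hn α G).order < (evalHom n hn γ G - evalHom n hn α G).order := by
      refine lt_of_lt_of_le ?_ h3
      have : (evalHom n hn α G).order = m := by rw [hm]; exact hG.symm
      rw [this]; exact_mod_cast Nat.lt_succ_self m
    have h5 : evalHom n hn γ G = evalHom n hn α G + (evalHom n hn γ G - evalHom n hn α G) := by
      ring
    rw [evalOrd, h5, PowerSeries.order_add_of_order_ne _ _ h4.ne, min_eq_left h4.le]
    rfl

theorem shiftVal_eq_evalOrd_of_le {G : K⟦X⟧[X]} (h : b ≤ b')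
    (hG : shiftVal n hn α b G = evalOrd n hn α G) :
    shiftVal n hn α b' G = evalOrd n hn α G :=
  le_antisymm (shiftVal_le_evalOrd_self G) (hG ▸ shiftVal_mono h G)

/-- For b = 0 the substitution in y is a translation, with inverse y ↦ y - α; both fix t, which
gives both inequalities. -/
theorem shiftVal_zero_right (G : K⟦X⟧[X]) :
    shiftVal n hn α 0 G = n * initialVal G := by
  rw [← initialVal_map_expand n hn, shiftVal]
  have h1 : (G.map (expandHom n hn)).eval₂ Polynomial.C (Polynomial.C α + Polynomial.X) =
      shiftHom n hn α 0 G := by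
    simp [shiftHom, Polynomial.eval₂_map]
  have h2 : (shiftHom n hn α 0 G).eval₂ Polynomial.C (Polynomial.X - Polynomial.C α) =
      G.map (expandHom n hn) := by
    have : (Polynomial.eval₂RingHom Polynomial.C (Polynomial.X - Polynomial.C α)).comp
        (shiftHom n hn α 0) = Polynomial.mapRingHom (expandHom n hn) := by
      apply Polynomial.ringHom_ext
      · intro a; simp [shiftHom]
      · simp [shiftHom]
    exact congrArg (fun φ => φ G) this
  apply le_antisymm
  · exact initialVal_le_of_dvd (Polynomial.eval₂RingHom Polynomial.C _) (by simp) h2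
  · exact initialVal_le_of_dvd (Polynomial.eval₂RingHom Polynomial.C _) (by simp) h1

/-! ### Adic expansions -/

section Adic
variable {ψ F G : K⟦X⟧[X]}

theorem adicCoeff_zero (ψ G : K⟦X⟧[X]) : adicCoeff ψ G 0 = G %ₘ ψ := by
  simp [adicCoeff]

theorem divByMonic_divByMonic {p q : K⟦X⟧[X]} (hp : p.Monic) (hq : q.Monic) (G : K⟦X⟧[X]) :
    (G /ₘ p) /ₘ q = G /ₘ (p * q) := by
  refine (Polynomial.div_modByMonic_unique ((G /ₘ p) /ₘ q)
    (G %ₘ p + p * ((G /ₘ p) %ₘ q)) (hp.mul hq) ⟨?_, ?_⟩).1.symm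
  · conv_rhs => rw [← Polynomial.modByMonic_add_div G p]
    conv_rhs => rw [← Polynomial.modByMonic_add_div (G /ₘ p) q]
    ring
  · have h1 := Polynomial.degree_modByMonic_lt G hp
    have h2 := Polynomial.degree_modByMonic_lt (G /ₘ p) hq
    have h3 : p.degree ≤ (p * q).degree := by
      rw [Polynomial.degree_mul]
      have : 0 ≤ q.degree := by
        rw [Polynomial.degree_eq_natDegree hq.ne_zero]; exact_mod_cast Nat.zero_le _
      exact le_add_of_nonneg_right this
    refine (Polynomial.degree_add_le _ _).trans_lt (max_lt (h1.trans_le h3) ?_)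
    rw [Polynomial.degree_mul, Polynomial.degree_mul]
    rw [Polynomial.degree_eq_natDegree hp.ne_zero]
    exact WithBot.add_lt_add_left (by simp) h2

theorem adicCoeff_succ (hψ : ψ.Monic) (G : K⟦X⟧[X]) (i : ℕ) :
    adicCoeff ψ G (i + 1) = adicCoeff ψ (G /ₘ ψ) i := by
  rw [adicCoeff, adicCoeff, divByMonic_divByMonic hψ (hψ.pow i), pow_succ']

theorem degree_adicCoeff_lt (hψ : ψ.Monic) (G : K⟦X⟧[X]) (i : ℕ) :
    (adicCoeff ψ G i).degree < ψ.degree :=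
  Polynomial.degree_modByMonic_lt _ hψ

theorem natDegree_divByMonic_lt (hψ : ψ.Monic) {M : ℕ}
    (hG : G.natDegree < (M + 1) * ψ.natDegree) : M = 0 ∨ (G /ₘ ψ).natDegree < M * ψ.natDegree := by
  rcases Nat.eq_zero_or_pos M with h | h
  · exact Or.inl h
  · right
    have h1 : 0 < ψ.natDegree := by
      rcases Nat.eq_zero_or_pos ψ.natDegree with h | h
      · simp [h] at hG
      · exact h
    rw [Polynomial.natDegree_divByMonic _ hψ]
    have h2 : 0 < M * ψ.natDegree := Nat.mul_pos h h1
    rw [add_mul, one_mul] at hG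
    omega

theorem eq_sum_adicCoeff (hψ : ψ.Monic) {M : ℕ} (hG : G.natDegree < M * ψ.natDegree) :
    G = ∑ i ∈ Finset.range M, adicCoeff ψ G i * ψ ^ i := by
  induction M generalizing G with
  | zero => simp at hG
  | succ M ih =>
    rw [Finset.sum_range_succ', adicCoeff_zero, pow_zero, mul_one]
    conv_lhs => rw [← Polynomial.modByMonic_add_div G ψ]
    rw [add_comm]
    congr 1
    rcases natDegree_divByMonic_lt hψ hG with h | h
    · subst h
      have : G /ₘ ψ = 0 := by
        rw [Polynomial.divByMonic_eq_zero_iff hψ]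
        exact Polynomial.degree_lt_degree (by simpa using hG)
      simp [this]
    · conv_lhs => rw [ih h]
      rw [Finset.mul_sum]
      refine Finset.sum_congr rfl fun i _ => ?_
      rw [adicCoeff_succ hψ, pow_succ]; ring

theorem adicCoeff_eq_zero (hψ : ψ.Monic) {i : ℕ} (hG : G.natDegree < i * ψ.natDegree) :
    adicCoeff ψ G i = 0 := by
  have : G /ₘ ψ ^ i = 0 := by
    rw [Polynomial.divByMonic_eq_zero_iff (hψ.pow i)]
    exact Polynomial.degree_lt_degree (by rwa [hψ.natDegree_pow])
  simp [adicCoeff, this]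

theorem divByMonic_pow_eq_one (hψ : ψ.Monic) (hF : F.Monic) {N : ℕ}
    (h : F.natDegree = N * ψ.natDegree) : F /ₘ ψ ^ N = 1 := by
  have hle : (ψ ^ N).degree ≤ F.degree := by
    rw [Polynomial.degree_eq_natDegree hF.ne_zero,
      Polynomial.degree_eq_natDegree (hψ.pow N).ne_zero, hψ.natDegree_pow, h]
  have hm : (F /ₘ ψ ^ N).Monic := by
    rw [Polynomial.Monic, Polynomial.leadingCoeff_divByMonic_of_monic (hψ.pow N) hle]
    exact hF
  rw [← hm.natDegree_eq_zero, Polynomial.natDegree_divByMonic _ (hψ.pow N),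
    hψ.natDegree_pow, h, Nat.sub_self]

theorem adicCoeff_top (hψ : ψ.Monic) (hψ0 : 0 < ψ.natDegree) (hF : F.Monic) {N : ℕ}
    (h : F.natDegree = N * ψ.natDegree) : adicCoeff ψ F N = 1 := by
  rw [adicCoeff, divByMonic_pow_eq_one hψ hF h, Polynomial.modByMonic_eq_self_iff hψ]
  exact Polynomial.degree_lt_degree (by simpa using hψ0)

theorem adicCoeff_map {L : Type*} [Field L] (g : K⟦X⟧ →+* L⟦X⟧) (hψ : ψ.Monic) (i : ℕ) :
    adicCoeff (ψ.map g) (G.map g) i = (adicCoeff ψ G i).map g := by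
  rw [adicCoeff, adicCoeff, Polynomial.map_modByMonic g hψ, Polynomial.map_divByMonic g (hψ.pow i),
    Polynomial.map_pow]

/-! ### Approximate roots -/

/-- The Tschirnhausen transform of `ψ` with respect to `F`. -/
def tschirnhausen (F : K⟦X⟧[X]) (N : ℕ) (ψ : K⟦X⟧[X]) : K⟦X⟧[X] :=
  ψ + Polynomial.C (PowerSeries.C ((N : K)⁻¹)) * adicCoeff ψ F (N - 1)

/-- The quotient of F by ψ^N is 1, so the quotient by ψ^(N-1) is ψ plus the adic coefficient of
index N - 1. -/
theorem exists_sub_pow_eq (hψ : ψ.Monic) (hF : F.Monic) {N : ℕ} (hN : 0 < N)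
    (h : F.natDegree = N * ψ.natDegree) :
    ∃ r : K⟦X⟧[X], F - ψ ^ N = adicCoeff ψ F (N - 1) * ψ ^ (N - 1) + r ∧
      r.degree < (((N - 1) * ψ.natDegree : ℕ) : WithBot ℕ) := by
  obtain ⟨k, rfl⟩ := Nat.exists_eq_add_of_le' hN
  refine ⟨F %ₘ ψ ^ k, ?_, ?_⟩
  · have h1 := Polynomial.modByMonic_add_div F (ψ ^ k)
    have h2 := Polynomial.modByMonic_add_div (F /ₘ ψ ^ k) ψ
    have h3 : F /ₘ ψ ^ k /ₘ ψ = 1 := by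
      rw [divByMonic_divByMonic (hψ.pow k) hψ, ← pow_succ]
      exact divByMonic_pow_eq_one hψ hF h
    rw [h3] at h2
    have h4 : F /ₘ ψ ^ k = adicCoeff ψ F k + ψ := by
      rw [adicCoeff]
      conv_lhs => rw [← h2]
      ring
    rw [Nat.add_sub_cancel]
    conv_lhs => rw [← h1, h4]
    ring
  · have := Polynomial.degree_modByMonic_lt F (hψ.pow k)
    rw [Polynomial.degree_eq_natDegree (hψ.pow k).ne_zero, hψ.natDegree_pow] at this
    simpa using this

/-- Binomial expansion to first order: what remains is divisible by u², and trading a factor ψ for a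
second factor u lowers the degree since k < deg ψ. -/
theorem degree_add_pow_sub_lt (hψ : ψ.Monic) {u : K⟦X⟧[X]} {k : ℕ} (hu : u.degree ≤ k)
    (hk : k < ψ.natDegree) (N : ℕ) :
    ((ψ + u) ^ (N + 1) - ψ ^ (N + 1) - ((N + 1 : ℕ) : K⟦X⟧[X]) * (u * ψ ^ N)).degree <
      ((N * ψ.natDegree + k : ℕ) : WithBot ℕ) := by
  induction N with
  | zero => simp
  | succ N ih =>
    have h1 : (ψ + u) ^ (N + 1 + 1) - ψ ^ (N + 1 + 1) -
        ((N + 1 + 1 : ℕ) : K⟦X⟧[X]) * (u * ψ ^ (N + 1)) =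
        (ψ + u) * ((ψ + u) ^ (N + 1) - ψ ^ (N + 1) - ((N + 1 : ℕ) : K⟦X⟧[X]) * (u * ψ ^ N)) +
        ((N + 1 : ℕ) : K⟦X⟧[X]) * (u * u * ψ ^ N) := by push_cast; ring
    have hψd : ψ.degree = (ψ.natDegree : WithBot ℕ) :=
      Polynomial.degree_eq_natDegree hψ.ne_zero
    have hlt : u.degree < ψ.degree := by
      rw [hψd]; exact hu.trans_lt (by exact_mod_cast hk)
    rw [h1]
    refine (Polynomial.degree_add_le _ _).trans_lt (max_lt ?_ ?_)
    · rw [Polynomial.degree_mul, Polynomial.degree_add_eq_left_of_degree_lt hlt, hψd]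
      have : (((N + 1) * ψ.natDegree + k : ℕ) : WithBot ℕ) =
          (ψ.natDegree : WithBot ℕ) + ((N * ψ.natDegree + k : ℕ) : WithBot ℕ) := by
        rw [← Nat.cast_add]
        congr 1; ring
      rw [this]
      exact WithBot.add_lt_add_left (by simp) ih
    · have hcast : (((N + 1 : ℕ) : K⟦X⟧[X])).degree ≤ 0 := Polynomial.degree_natCast_le _
      have h2 : (((N + 1 : ℕ) : K⟦X⟧[X]) * (u * u * ψ ^ N)).degree ≤
          ((0 + (k + k + N * ψ.natDegree) : ℕ) : WithBot ℕ) := by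
        push_cast
        rw [Polynomial.degree_mul, Polynomial.degree_mul, Polynomial.degree_mul,
          Polynomial.degree_pow, hψd]
        push_cast at hcast
        simp only [nsmul_eq_mul]
        gcongr
      refine h2.trans_lt ?_
      rw [Nat.cast_lt, add_mul]
      omega

theorem degree_C_mul_le (c : K⟦X⟧) (u : K⟦X⟧[X]) : (Polynomial.C c * u).degree ≤ u.degree := by
  rw [← Polynomial.smul_eq_C_mul]
  exact Polynomial.degree_smul_le _ _

theorem tschirnhausen_monic (hψ : ψ.Monic) (F : K⟦X⟧[X]) (N : ℕ) :
    (tschirnhausen F N ψ).Monic ∧ (tschirnhausen F N ψ).natDegree = ψ.natDegree := by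
  have h : (Polynomial.C (PowerSeries.C ((N : K)⁻¹)) * adicCoeff ψ F (N - 1)).degree <
      ψ.degree := (degree_C_mul_le _ _).trans_lt (degree_adicCoeff_lt hψ F _)
  exact ⟨hψ.add_of_left h, Polynomial.natDegree_add_eq_left_of_degree_lt h⟩

/-- The correction u = c / N is chosen so that the first order term N u ψ^(N-1) of (ψ + u)^N absorbs
c ψ^(N-1). Only terms of degree below (N - 1) deg ψ + deg c are left for the new coefficient. -/
theorem adicCoeff_tschirnhausen (hψ : ψ.Monic) (hF : F.Monic) {N : ℕ}
    (hN : (N : K) ≠ 0) (h : F.natDegree = N * ψ.natDegree)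
    (h0 : adicCoeff ψ F (N - 1) ≠ 0) :
    (adicCoeff (tschirnhausen F N ψ) F (N - 1)).degree < (adicCoeff ψ F (N - 1)).degree := by
  have hN0 : 0 < N := Nat.pos_of_ne_zero (by rintro rfl; simp at hN)
  obtain ⟨hm, hd⟩ := tschirnhausen_monic hψ F N
  obtain ⟨r, hr, hrd⟩ := exists_sub_pow_eq hψ hF hN0 h
  obtain ⟨r', hr', hrd'⟩ := exists_sub_pow_eq hm hF hN0 (by rw [hd]; exact h)
  set c := adicCoeff ψ F (N - 1) with hc
  set ψ' := tschirnhausen F N ψ with hψ'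
  set c' := adicCoeff ψ' F (N - 1) with hc'
  set u := Polynomial.C (PowerSeries.C ((N : K)⁻¹)) * c with hu
  have hcd : c.degree = (c.natDegree : WithBot ℕ) := Polynomial.degree_eq_natDegree h0
  have hk : c.natDegree < ψ.natDegree :=
    Polynomial.natDegree_lt_natDegree h0 (degree_adicCoeff_lt hψ F _)
  have hD := degree_add_pow_sub_lt hψ (u := u) (k := c.natDegree)
    ((degree_C_mul_le _ _).trans hcd.le) hk (N - 1)
  rw [Nat.sub_add_cancel hN0] at hD
  have hNu : (N : K⟦X⟧[X]) * (u * ψ ^ (N - 1)) = c * ψ ^ (N - 1) := by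
    have : (N : K⟦X⟧[X]) * Polynomial.C (PowerSeries.C ((N : K)⁻¹)) = 1 := by
      rw [← Polynomial.C_eq_natCast, ← Polynomial.C_mul, ← map_natCast (PowerSeries.C (R := K)),
        ← map_mul, mul_inv_cancel₀ hN, map_one, map_one]
    rw [hu]
    calc _ = ((N : K⟦X⟧[X]) * Polynomial.C (PowerSeries.C ((N : K)⁻¹))) * (c * ψ ^ (N - 1)) := by
          ring
      _ = _ := by rw [this, one_mul]
  rw [hNu] at hD
  -- Comparison of the two expansions of F, around ψ and around ψ' = ψ + u.
  have key : c' * ψ' ^ (N - 1) =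
      r - r' - ((ψ + u) ^ N - ψ ^ N - c * ψ ^ (N - 1)) := by
    have e1 : ψ' = ψ + u := rfl
    have e2 : c' * ψ' ^ (N - 1) = F - ψ' ^ N - r' := by rw [hr']; ring
    have e3 : r = F - ψ ^ N - c * ψ ^ (N - 1) := by rw [hr]; ring
    rw [e2, e3, e1]; ring
  have hb : (((N - 1) * ψ.natDegree : ℕ) : WithBot ℕ) ≤
      (((N - 1) * ψ.natDegree + c.natDegree : ℕ) : WithBot ℕ) := by
    exact_mod_cast Nat.le_add_right _ _
  have hlt : (c' * ψ' ^ (N - 1)).degree <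
      (((N - 1) * ψ.natDegree + c.natDegree : ℕ) : WithBot ℕ) := by
    rw [key]
    refine (Polynomial.degree_sub_le _ _).trans_lt (max_lt ?_ hD)
    refine (Polynomial.degree_sub_le _ _).trans_lt (max_lt (hrd.trans_le hb) ?_)
    rw [hd] at hrd'
    exact hrd'.trans_le hb
  by_cases hc0 : c' = 0
  · rw [hc0, Polynomial.degree_zero]
    -- The zero polynomial has degree ⊥, so this case needs `h0`.
    exact bot_lt_iff_ne_bot.2 (by simpa using h0)
  · have hne : c' * ψ' ^ (N - 1) ≠ 0 := mul_ne_zero hc0 (hm.pow _).ne_zero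
    rw [Polynomial.degree_eq_natDegree hne, Polynomial.natDegree_mul hc0 (hm.pow _).ne_zero,
      hm.natDegree_pow, hd, Nat.cast_lt] at hlt
    rw [hcd, Polynomial.degree_eq_natDegree hc0, Nat.cast_lt]
    omega

theorem isApproxRoot_of_adicCoeff_eq_zero (hψ : ψ.Monic) (hF : F.Monic) {N : ℕ} (hN : 0 < N)
    (h : F.natDegree = N * ψ.natDegree) (h0 : adicCoeff ψ F (N - 1) = 0) :
    IsApproxRoot F N ψ := by
  obtain ⟨r, hr, hrd⟩ := exists_sub_pow_eq hψ hF hN h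
  refine ⟨hψ, ?_, ?_⟩
  · rw [h, Nat.mul_div_cancel_left _ hN]
  · rw [hr, h0, zero_mul, zero_add, h, Nat.mul_div_cancel_left _ hN, ← Nat.sub_one_mul]
    exact hrd

/-- Iterating the Tschirnhausen transform leads to the approximate root. -/
theorem exists_isApproxRoot_of_tschirnhausen (hF : F.Monic) {N e : ℕ}
    (hN : (N : K) ≠ 0) (h : F.natDegree = N * e) (Q : K⟦X⟧[X] → Prop)
    (hQ : ∀ ψ : K⟦X⟧[X], ψ.Monic → ψ.natDegree = e → Q ψ → Q (tschirnhausen F N ψ))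
    {φ : K⟦X⟧[X]} (hφ : φ.Monic) (hφe : φ.natDegree = e) (hφQ : Q φ) :
    ∃ ψ, IsApproxRoot F N ψ ∧ Q ψ := by
  have hN0 : 0 < N := Nat.pos_of_ne_zero (by rintro rfl; simp at hN)
  induction hd : (adicCoeff φ F (N - 1)).degree using WellFoundedLT.induction generalizing φ with
  | ind δ ih =>
    by_cases h0 : adicCoeff φ F (N - 1) = 0
    · exact ⟨φ, isApproxRoot_of_adicCoeff_eq_zero hφ hF hN0 (hφe ▸ h) h0, hφQ⟩
    · obtain ⟨h1, h2⟩ := tschirnhausen_monic hφ F N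
      refine ih _ ?_ h1 (h2.trans hφe) (hQ φ hφ hφe hφQ) rfl
      rw [← hd]
      exact adicCoeff_tschirnhausen hφ hF hN (hφe ▸ h) h0

/-- In ψ^N - ψ'^N = S (ψ - ψ') the coefficient of S in degree (N - 1) e is N, which is nonzero. A
nonzero ψ - ψ' would make the product too large in degree. -/
theorem IsApproxRoot.unique {N : ℕ} (hN : (N : K) ≠ 0) (hd : N ∣ F.natDegree)
    {ψ ψ' : K⟦X⟧[X]} (h : IsApproxRoot F N ψ) (h' : IsApproxRoot F N ψ') : ψ = ψ' := by
  by_contra hne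
  have hN0 : 0 < N := Nat.pos_of_ne_zero (by rintro rfl; simp at hN)
  obtain ⟨e, he⟩ := hd
  have hdiv : F.natDegree / N = e := by rw [he, Nat.mul_div_cancel_left _ hN0]
  obtain ⟨h1, h2, h3⟩ := h
  obtain ⟨h1', h2', h3'⟩ := h'
  rw [hdiv] at h2 h2' h3 h3'
  set S := ∑ i ∈ Finset.range N, ψ ^ i * ψ' ^ (N - 1 - i) with hS
  have hmul : S * (ψ - ψ') = ψ ^ N - ψ' ^ N := by rw [hS, Commute.geom_sum₂_mul (Commute.all _ _)]
  have hcoeff : S.coeff ((N - 1) * e) = (N : K⟦X⟧) := by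
    rw [hS, Polynomial.finsetSum_coeff]
    rw [Finset.sum_congr rfl (g := fun _ => (1 : K⟦X⟧))]
    · simp
    · intro i hi
      have hi' := Finset.mem_range.1 hi
      have hm : (ψ ^ i * ψ' ^ (N - 1 - i)).Monic := (h1.pow i).mul (h1'.pow _)
      have hnd : (ψ ^ i * ψ' ^ (N - 1 - i)).natDegree = (N - 1) * e := by
        rw [(h1.pow i).natDegree_mul (h1'.pow _), h1.natDegree_pow, h1'.natDegree_pow, h2, h2',
          ← add_mul]
        congr 1; omega
      rw [← hnd]; exact hm.coeff_natDegree
  have hSne : S.coeff ((N - 1) * e) ≠ 0 := by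
    rw [hcoeff, ← map_natCast (PowerSeries.C (R := K))]
    exact fun h => hN ((map_eq_zero _).1 h)
  have hSd := Polynomial.le_degree_of_ne_zero hSne
  have hlt : (S * (ψ - ψ')).degree < ((F.natDegree - e : ℕ) : WithBot ℕ) := by
    rw [hmul]
    have : ψ ^ N - ψ' ^ N = (F - ψ' ^ N) - (F - ψ ^ N) := by ring
    rw [this]
    exact (Polynomial.degree_sub_le _ _).trans_lt (max_lt h3' h3)
  rw [Polynomial.degree_mul, he, ← Nat.sub_one_mul] at hlt
  have h0 : (0 : WithBot ℕ) ≤ (ψ - ψ').degree := by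
    rw [Polynomial.degree_eq_natDegree (sub_ne_zero.2 hne)]; exact_mod_cast Nat.zero_le _
  exact absurd (hSd.trans (le_add_of_nonneg_right h0)) (not_le.2 hlt)

theorem isApproxRoot_approxRoot (hF : F.Monic) {N : ℕ} (hN : (N : K) ≠ 0)
    (hd : N ∣ F.natDegree) : IsApproxRoot F N (approxRoot F N) := by
  obtain ⟨e, he⟩ := hd
  obtain ⟨ψ, hψ, -⟩ := exists_isApproxRoot_of_tschirnhausen hF hN he (fun _ => True)
    (fun _ _ _ _ => trivial) (Polynomial.monic_X_pow e) (Polynomial.natDegree_X_pow e) trivial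
  have hex : ∃ ψ, IsApproxRoot F N ψ := ⟨ψ, hψ⟩
  rw [approxRoot, dif_pos hex]
  exact hex.choose_spec

theorem IsApproxRoot.eq_approxRoot (hF : F.Monic) {N : ℕ} (hN : (N : K) ≠ 0)
    (hd : N ∣ F.natDegree) {ψ : K⟦X⟧[X]} (h : IsApproxRoot F N ψ) :
    approxRoot F N = ψ :=
  (isApproxRoot_approxRoot hF hN hd).unique hN hd h

theorem approxRoot_map {L : Type*} [Field L] (f : K →+* L) (hF : F.Monic) {N : ℕ}
    (hN : (N : K) ≠ 0) (hd : N ∣ F.natDegree) :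
    approxRoot (F.map (PowerSeries.map f)) N = (approxRoot F N).map (PowerSeries.map f) := by
  obtain ⟨h1, h2, h3⟩ := isApproxRoot_approxRoot hF hN hd
  have hdeg : (F.map (PowerSeries.map f)).natDegree = F.natDegree := hF.natDegree_map _
  refine IsApproxRoot.eq_approxRoot (hF.map _) ?_ (by rwa [hdeg])
    ⟨h1.map _, ?_, ?_⟩
  · rw [← map_natCast f]
    exact fun h => hN ((map_eq_zero f).1 h)
  · rw [h1.natDegree_map, hdeg, h2]
  · rw [hdeg, ← Polynomial.map_pow, ← Polynomial.map_sub]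
    exact Polynomial.degree_map_le.trans_lt h3

end Adic

/-! ### Conjugate series -/

section Conj
variable {n : ℕ} {hn : n ≠ 0} {ω : K}

/-- Invariance under t ↦ ωt kills every coefficient whose index is not a multiple of n. This
descends conjugation-invariant data from t to x. -/
theorem exists_expandHom_eq (hω : IsPrimitiveRoot ω n) {f : K⟦X⟧}
    (hf : PowerSeries.rescale ω f = f) : ∃ g, expandHom n hn g = f := by
  refine ⟨PowerSeries.mk fun i => PowerSeries.coeff (n * i) f, ?_⟩
  ext i
  rw [coeff_expandHom]
  split_ifs with h
  · rw [PowerSeries.coeff_mk, Nat.mul_div_cancel' h]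
  · have h1 := congrArg (PowerSeries.coeff i) hf
    rw [PowerSeries.coeff_rescale] at h1
    by_contra h0
    have h2 : ω ^ i = 1 := mul_right_cancel₀ (Ne.symm h0) (by rw [h1, one_mul])
    exact h (hω.dvd_of_pow_eq_one i h2)

theorem exists_map_expandHom_eq (hω : IsPrimitiveRoot ω n) {P : K⟦X⟧[X]} (hP : P.Monic)
    (h : P.map (PowerSeries.rescale ω) = P) :
    ∃ φ : K⟦X⟧[X], φ.map (expandHom n hn) = P ∧ φ.natDegree = P.natDegree ∧ φ.Monic := by
  refine Polynomial.lifts_and_natDegree_eq_and_monic ?_ hP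
  rw [Polynomial.lifts_iff_coeff_lifts]
  intro i
  obtain ⟨g, hg⟩ := exists_expandHom_eq (hn := hn) hω (f := P.coeff i)
    (by rw [← Polynomial.coeff_map, h])
  exact ⟨g, hg⟩

/-- The product of the linear factors attached to the conjugates of `β`. -/
def conjProd (ω : K) (e : ℕ) (β : K⟦X⟧) : K⟦X⟧[X] :=
  ∏ j ∈ Finset.range e, (Polynomial.X - Polynomial.C (PowerSeries.rescale (ω ^ j) β))

theorem conjProd_monic (ω : K) (e : ℕ) (β : K⟦X⟧) : (conjProd ω e β).Monic :=
  Polynomial.monic_prod_of_monic _ _ fun _ _ => Polynomial.monic_X_sub_C _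

theorem natDegree_conjProd (ω : K) (e : ℕ) (β : K⟦X⟧) : (conjProd ω e β).natDegree = e := by
  rw [conjProd, Polynomial.natDegree_prod_of_monic _ _ fun _ _ => Polynomial.monic_X_sub_C _]
  simp

/-- Rescaling shifts the index of the factors by one, and the factor of index e coincides with that
of index 0. -/
theorem conjProd_map_rescale {e : ℕ} {β : K⟦X⟧} (h : PowerSeries.rescale (ω ^ e) β = β) :
    (conjProd ω e β).map (PowerSeries.rescale ω) = conjProd ω e β := by
  have h1 : (conjProd ω e β).map (PowerSeries.rescale ω) = ∏ j ∈ Finset.range e,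
      (Polynomial.X - Polynomial.C (PowerSeries.rescale (ω ^ (j + 1)) β)) := by
    rw [conjProd, Polynomial.map_prod]
    refine Finset.prod_congr rfl fun j _ => ?_
    rw [Polynomial.map_sub, Polynomial.map_X, Polynomial.map_C, PowerSeries.rescale_rescale,
      ← pow_succ]
  have h2 := Finset.prod_range_succ (fun j => (Polynomial.X -
    Polynomial.C (PowerSeries.rescale (ω ^ j) β) : K⟦X⟧[X])) e
  rw [Finset.prod_range_succ'] at h2
  rw [h1]
  -- Both products become the product over e + 1 consecutive indices after multiplication by y - β.
  refine mul_right_cancel₀ (Polynomial.X_sub_C_ne_zero β) ?_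
  simpa [h, conjProd] using h2

theorem exists_conjProd_eq_map (hω : IsPrimitiveRoot ω n) {e : ℕ} {β : K⟦X⟧}
    (h : PowerSeries.rescale (ω ^ e) β = β) :
    ∃ φ : K⟦X⟧[X], φ.map (expandHom n hn) = conjProd ω e β ∧ φ.natDegree = e ∧ φ.Monic := by
  obtain ⟨φ, h1, h2, h3⟩ := exists_map_expandHom_eq (hn := hn) hω (conjProd_monic ω e β)
    (conjProd_map_rescale h)
  exact ⟨φ, h1, h2.trans (natDegree_conjProd _ _ _), h3⟩

theorem shiftVal_of_map_eq_conjProd {α β : K⟦X⟧} {e c : ℕ} {φ : K⟦X⟧[X]}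
    (h : φ.map (expandHom n hn) = conjProd ω e β) :
    shiftVal n hn α c φ =
      ∑ j ∈ Finset.range e, min (α - PowerSeries.rescale (ω ^ j) β).order (c : ℕ∞) := by
  have h1 : shiftHom n hn α c φ = (conjProd ω e β).eval₂ Polynomial.C
      (Polynomial.C α + Polynomial.C (PowerSeries.X ^ c) * Polynomial.X) := by
    rw [← h, Polynomial.eval₂_map]; rfl
  rw [shiftVal, h1, conjProd, Polynomial.eval₂_finsetProd, initialVal_prod]
  refine Finset.sum_congr rfl fun j _ => ?_
  rw [← PowerSeries.order_X_pow (R := K) c, ← initialVal_C_add_C_mul_X]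
  congr 1
  simp only [Polynomial.eval₂_sub, Polynomial.eval₂_X, Polynomial.eval₂_C, Polynomial.C_sub]
  ring

theorem evalOrd_of_map_eq_conjProd {β γ : K⟦X⟧} {e : ℕ} {φ : K⟦X⟧[X]}
    (h : φ.map (expandHom n hn) = conjProd ω e β) :
    evalOrd n hn γ φ =
      ∑ j ∈ Finset.range e, (γ - PowerSeries.rescale (ω ^ j) β).order := by
  rw [evalOrd, evalHom_eq_eval_map, h, conjProd, Polynomial.eval_prod, PowerSeries.order_prod]
  simp

theorem evalHom_of_map_eq_conjProd {α : K⟦X⟧} {e : ℕ} (he : 0 < e) {φ : K⟦X⟧[X]}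
    (h : φ.map (expandHom n hn) = conjProd ω e α) : evalHom n hn α φ = 0 := by
  rw [evalHom_eq_eval_map, h, conjProd, Polynomial.eval_prod]
  exact Finset.prod_eq_zero (Finset.mem_range.2 he) (by simp)

end Conj

/-! ### Characteristic exponents -/

/-- The exponents of `α` up to `b` generate together with `n = N * e` the ideal `N ℤ`. -/
structure IsLevel (n : ℕ) (α : K⟦X⟧) (e N b : ℕ) : Prop where
  eq_mul : n = N * e
  dvd : N ∣ b
  dvd_of_coeff_ne_zero : ∀ i ≤ b, PowerSeries.coeff i α ≠ 0 → N ∣ i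
  dvd_of_forall : ∀ j, (∀ i ≤ b, PowerSeries.coeff i α ≠ 0 → n ∣ i * j) → e ∣ j

/-- `b'` is the first exponent of `α` which is not divisible by `N`. -/
structure IsNextExponent (α : K⟦X⟧) (N b b' : ℕ) : Prop where
  lt : b < b'
  coeff_ne_zero : PowerSeries.coeff b' α ≠ 0
  not_dvd : ¬ N ∣ b'
  dvd_of_lt : ∀ i < b', PowerSeries.coeff i α ≠ 0 → N ∣ i

/-- The part of the series `α` of degree less than `b`. -/
def cut (b : ℕ) (α : K⟦X⟧) : K⟦X⟧ :=
  PowerSeries.mk fun i => if i < b then PowerSeries.coeff i α else 0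

theorem X_pow_dvd_cut_sub (b : ℕ) (α : K⟦X⟧) : PowerSeries.X ^ b ∣ cut b α - α := by
  rw [PowerSeries.X_pow_dvd_iff]
  intro i hi
  simp [cut, hi]

theorem IsLevel.zero {n : ℕ} (α : K⟦X⟧) : IsLevel n α 1 n 0 where
  eq_mul := (mul_one n).symm
  dvd := dvd_zero n
  dvd_of_coeff_ne_zero i hi _ := by rw [Nat.le_zero.1 hi]; exact dvd_zero n
  dvd_of_forall j _ := one_dvd j

theorem IsLevel.exists_next {n e N b : ℕ} {α : K⟦X⟧} (h : IsLevel n α e N b) (hN : N ≠ 1)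
    (hα : ∀ m, m ∣ n → (∀ i, PowerSeries.coeff i α ≠ 0 → m ∣ i) → m = 1) :
    ∃ b', IsNextExponent α N b b' := by
  classical
  have hex : ∃ i, PowerSeries.coeff i α ≠ 0 ∧ ¬ N ∣ i := by
    by_contra hcon
    push Not at hcon
    exact hN (hα N ⟨e, h.eq_mul⟩ hcon)
  refine ⟨Nat.find hex, ?_, (Nat.find_spec hex).1, (Nat.find_spec hex).2, fun i hi h0 => ?_⟩
  · by_contra hlt
    exact (Nat.find_spec hex).2
      (h.dvd_of_coeff_ne_zero _ (not_lt.1 hlt) (Nat.find_spec hex).1)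
  · by_contra hd
    exact Nat.find_min hex hi ⟨h0, hd⟩

theorem IsLevel.next {n e N b b' q g : ℕ} {α : K⟦X⟧} (h : IsLevel n α e N b) (hn : n ≠ 0)
    (h' : IsNextExponent α N b b') (hg : g = Nat.gcd N b') (hq : N = g * q) :
    IsLevel n α (q * e) g b' where
  eq_mul := by rw [h.eq_mul, hq, mul_assoc]
  dvd := hg ▸ Nat.gcd_dvd_right N b'
  dvd_of_coeff_ne_zero i hi h0 := by
    rcases hi.lt_or_eq with hi | rfl
    · exact (Dvd.intro q hq.symm).trans (h'.dvd_of_lt i hi h0)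
    · exact hg ▸ Nat.gcd_dvd_right N i
  dvd_of_forall j hj := by
    obtain ⟨j', rfl⟩ := h.dvd_of_forall j fun i hi h0 => hj i (hi.trans h'.lt.le) h0
    have he : 0 < e := Nat.pos_of_ne_zero (by rintro rfl; exact hn h.eq_mul)
    have h1 := hj b' le_rfl h'.coeff_ne_zero
    rw [h.eq_mul] at h1
    have h2 : N ∣ b' * j' := by
      have : N * e ∣ (b' * j') * e := by convert h1 using 1; ring
      exact Nat.dvd_of_mul_dvd_mul_right he this
    have hg0 : 0 < g := Nat.pos_of_ne_zero (by
      rintro rfl; exact hn (by rw [h.eq_mul, hq]; simp))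
    obtain ⟨c, hc⟩ : g ∣ b' := hg ▸ Nat.gcd_dvd_right N b'
    have h3 : Nat.Coprime q c := by
      have : g * Nat.gcd q c = g * 1 := by rw [← Nat.gcd_mul_left, ← hq, ← hc, ← hg, mul_one]
      exact Nat.eq_of_mul_eq_mul_left hg0 this
    have h4 : q ∣ j' := by
      refine h3.dvd_of_dvd_mul_left (Nat.dvd_of_mul_dvd_mul_left hg0 ?_)
      rw [← hq, ← mul_assoc, ← hc]
      exact h2
    rw [mul_comm q e]
    exact Nat.mul_dvd_mul_left e h4

theorem min_order_le_of_dvd_sub {f g : K⟦X⟧} {b : ℕ} {c : ℕ∞} (hc : c ≤ b)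
    (h : PowerSeries.X ^ b ∣ f - g) : min f.order c ≤ min g.order c := by
  refine le_min ?_ (min_le_right _ _)
  have h1 := PowerSeries.min_order_le_order_add f (-(f - g))
  rw [PowerSeries.order_neg, show f + -(f - g) = g by ring] at h1
  exact (min_le_min_left _ (hc.trans (natCast_le_order_iff.2 h))).trans h1

theorem min_order_eq_of_dvd_sub {f g : K⟦X⟧} {b : ℕ} {c : ℕ∞} (hc : c ≤ b)
    (h : PowerSeries.X ^ b ∣ f - g) : min f.order c = min g.order c :=
  le_antisymm (min_order_le_of_dvd_sub hc h)
    (min_order_le_of_dvd_sub hc (by rw [← neg_sub]; exact (dvd_neg).2 h))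

theorem sum_range_mul_of_periodic (f : ℕ → ℕ∞) (e N : ℕ) (hf : ∀ j, f (j + e) = f j) :
    ∑ j ∈ Finset.range (N * e), f j = N * ∑ j ∈ Finset.range e, f j := by
  have hper : ∀ N j, f (N * e + j) = f j := by
    intro N
    induction N with
    | zero => simp
    | succ N ih =>
      intro j
      rw [← ih j, ← hf (N * e + j)]
      congr 1; ring
  induction N with
  | zero => simp
  | succ N ih =>
    rw [Nat.succ_mul, Finset.sum_range_add, ih]
    simp only [hper]
    push_cast; ring

section Key
variable {n : ℕ} {hn : n ≠ 0} {ω : K} {α : K⟦X⟧} {e N b b' : ℕ}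

/-- The exponents of α below b' are multiples of N and n = N e, so ω^j acts trivially on them when e
divides j. -/
theorem rescale_cut (hω : IsPrimitiveRoot ω n) (h : IsLevel n α e N b)
    (h' : IsNextExponent α N b b') {j : ℕ} (hj : e ∣ j) :
    PowerSeries.rescale (ω ^ j) (cut b' α) = cut b' α := by
  ext i
  rw [PowerSeries.coeff_rescale, cut, PowerSeries.coeff_mk]
  split_ifs with hi
  · by_cases h0 : PowerSeries.coeff i α = 0
    · simp [h0]
    · rw [← pow_mul, (hω.pow_eq_one_iff_dvd _).2, one_mul]
      rw [h.eq_mul, mul_comm]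
      exact mul_dvd_mul hj (h'.dvd_of_lt i hi h0)
  · simp

theorem rescale_cut_add (hω : IsPrimitiveRoot ω n) (h : IsLevel n α e N b)
    (h' : IsNextExponent α N b b') (j : ℕ) :
    PowerSeries.rescale (ω ^ (j + e)) (cut b' α) = PowerSeries.rescale (ω ^ j) (cut b' α) := by
  rw [pow_add, mul_comm, ← PowerSeries.rescale_rescale, rescale_cut hω h h' dvd_rfl]

theorem order_sub_cut (h' : IsNextExponent α N b b') : (α - cut b' α).order = b' := by
  rw [PowerSeries.order_eq_nat]
  refine ⟨by simpa [cut] using h'.coeff_ne_zero, fun i hi => by simp [cut, hi]⟩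

/-- Some exponent i ≤ b of α has ω^(ij) ≠ 1, and it survives in the difference. -/
theorem order_sub_rescale_cut_le (hω : IsPrimitiveRoot ω n) (h : IsLevel n α e N b)
    (h' : IsNextExponent α N b b') {j : ℕ} (hj : ¬ e ∣ j) :
    (α - PowerSeries.rescale (ω ^ j) (cut b' α)).order ≤ b := by
  have : ∃ i ≤ b, PowerSeries.coeff i α ≠ 0 ∧ ¬ n ∣ i * j := by
    by_contra hcon
    push Not at hcon
    exact hj (h.dvd_of_forall j hcon)
  obtain ⟨i, hi, h0, hni⟩ := this
  refine (PowerSeries.order_le i ?_).trans (by exact_mod_cast hi)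
  rw [map_sub, PowerSeries.coeff_rescale, cut, PowerSeries.coeff_mk,
    if_pos (hi.trans_lt h'.lt), ← one_sub_mul, ← pow_mul]
  refine mul_ne_zero (sub_ne_zero.2 fun h1 => hni ?_) h0
  rw [mul_comm]
  exact (hω.pow_eq_one_iff_dvd _).1 h1.symm

/-- If e divides j, the conjugate of α still has its term of degree b' while the truncation has
none. Otherwise the contact order is at most b, where truncation is invisible. This bounds F at the
truncated series from above. -/
theorem order_cut_sub_rescale_le (hω : IsPrimitiveRoot ω n) (hn : n ≠ 0)
    (h : IsLevel n α e N b) (h' : IsNextExponent α N b b') (j : ℕ) :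
    (cut b' α - PowerSeries.rescale (ω ^ j) α).order ≤
      min (α - PowerSeries.rescale (ω ^ j) (cut b' α)).order (b' : ℕ∞) := by
  by_cases hj : e ∣ j
  · rw [rescale_cut hω h h' hj, order_sub_cut h', min_self]
    refine PowerSeries.order_le b' ?_
    rw [map_sub, PowerSeries.coeff_rescale, cut, PowerSeries.coeff_mk, if_neg (lt_irrefl _),
      zero_sub, neg_ne_zero]
    exact mul_ne_zero (pow_ne_zero _ (pow_ne_zero _ (hω.ne_zero hn))) h'.coeff_ne_zero
  · have hle := order_sub_rescale_cut_le hω h h' hj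
    have hlt : (b : ℕ∞) < b' := by exact_mod_cast h'.lt
    rw [min_eq_left (hle.trans hlt.le)]
    obtain ⟨r, hr⟩ := ENat.ne_top_iff_exists.1 (ne_top_of_le_ne_top (by simp) hle)
    have hrb : r < b' := by
      have := hle.trans_lt hlt
      rw [← hr] at this
      exact_mod_cast this
    rw [← hr]
    refine PowerSeries.order_le r ?_
    have hc := ((PowerSeries.order_eq_nat).1 hr.symm).1
    simpa [PowerSeries.coeff_rescale, cut, hrb] using hc

/-- The minimal polynomial `φ` of the truncated series, and the values it takes. -/
theorem exists_keyPoly (hn : n ≠ 0) (hω : IsPrimitiveRoot ω n) (h : IsLevel n α e N b)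
    (h' : IsNextExponent α N b b') :
    ∃ (φ : K⟦X⟧[X]) (R : ℕ), φ.Monic ∧ φ.natDegree = e ∧
      shiftVal n hn α b φ = (b + R : ℕ) ∧ shiftVal n hn α b' φ = (b' + R : ℕ) ∧
      evalOrd n hn α φ = (b' + R : ℕ) ∧ evalOrd n hn (cut b' α) φ = ⊤ ∧
      ∀ F : K⟦X⟧[X], F.map (expandHom n hn) = conjProd ω n α →
        shiftVal n hn α b F = (N * (b + R) : ℕ) ∧ shiftVal n hn α b' F = (N * (b' + R) : ℕ) ∧
        evalOrd n hn (cut b' α) F ≤ (N * (b' + R) : ℕ) := by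
  obtain ⟨φ, hφ, hφe, hφm⟩ := exists_conjProd_eq_map (hn := hn) hω (rescale_cut hω h h' dvd_rfl)
  have he : 0 < e := Nat.pos_of_ne_zero (by rintro rfl; exact hn h.eq_mul)
  obtain ⟨k, rfl⟩ := Nat.exists_eq_add_of_le' he
  set r : ℕ → ℕ∞ := fun j => (α - PowerSeries.rescale (ω ^ j) (cut b' α)).order with hr
  have hr0 : r 0 = b' := by simpa [hr] using order_sub_cut h'
  have hrs : ∀ j ∈ Finset.range k, r (j + 1) ≤ b := fun j hj =>
    order_sub_rescale_cut_le hω h h' fun hd =>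
      absurd (Nat.le_of_dvd (Nat.succ_pos j) hd) (by have := Finset.mem_range.1 hj; omega)
  -- R collects the contact orders of α with the nontrivial conjugates of its truncation. All are at
  -- most b, so capping at b or b' leaves them unchanged; only j = 0 distinguishes the two caps.
  set R := ∑ j ∈ Finset.range k, (r (j + 1)).toNat with hR
  have hRsum : ∑ j ∈ Finset.range k, r (j + 1) = R := by
    rw [hR, Nat.cast_sum]
    exact Finset.sum_congr rfl fun j hj =>
      (ENat.natCast_toNat (ne_top_of_le_ne_top (by simp) (hrs j hj))).symm
  have hmin : ∀ c : ℕ∞, (b : ℕ∞) ≤ c →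
      ∑ j ∈ Finset.range (k + 1), min (r j) c = min (b' : ℕ∞) c + R := by
    intro c hc
    rw [Finset.sum_range_succ', hr0, add_comm, ← hRsum]
    congr 1
    exact Finset.sum_congr rfl fun j hj => min_eq_left ((hrs j hj).trans hc)
  have hlt : (b : ℕ∞) ≤ b' := by exact_mod_cast h'.lt.le
  have hb : ∑ j ∈ Finset.range (k + 1), min (r j) (b : ℕ∞) = (b + R : ℕ) := by
    rw [hmin _ le_rfl, min_eq_right hlt]; push_cast; rfl
  have hb' : ∑ j ∈ Finset.range (k + 1), min (r j) (b' : ℕ∞) = (b' + R : ℕ) := by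
    rw [hmin _ hlt, min_self]; push_cast; rfl
  -- The n conjugates of the truncation run N times through its e conjugates.
  have hper : ∀ c : ℕ∞, ∑ j ∈ Finset.range n, min (r j) c =
      N * ∑ j ∈ Finset.range (k + 1), min (r j) c := by
    intro c
    rw [h.eq_mul]
    refine sum_range_mul_of_periodic (fun j => min (r j) c) _ _ fun j => ?_
    simp only [hr, rescale_cut_add hω h h']
  refine ⟨φ, R, hφm, hφe, ?_, ?_, ?_, ?_, fun F hF => ?_⟩
  · rw [shiftVal_of_map_eq_conjProd hφ]; exact hb
  · rw [shiftVal_of_map_eq_conjProd hφ]; exact hb'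
  · rw [evalOrd_of_map_eq_conjProd hφ, Finset.sum_range_succ']
    change _ + r 0 = _
    rw [hr0, add_comm]
    push_cast
    rw [← hRsum]
  · rw [evalOrd, evalHom_of_map_eq_conjProd he hφ, PowerSeries.order_zero]
  · have hF1 : ∀ c : ℕ, c ≤ b' → shiftVal n hn α c F =
        N * ∑ j ∈ Finset.range (k + 1), min (r j) (c : ℕ∞) := by
      intro c hc
      rw [shiftVal_of_map_eq_conjProd hF, ← hper]
      refine Finset.sum_congr rfl fun j _ => ?_
      refine min_order_eq_of_dvd_sub (b := b') (by exact_mod_cast hc) ?_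
      have h1 : PowerSeries.X ^ b' ∣ PowerSeries.rescale (ω ^ j) (cut b' α - α) := by
        rw [PowerSeries.X_pow_dvd_iff]
        intro i hi
        simp [PowerSeries.coeff_rescale, cut, hi]
      rw [map_sub] at h1
      convert h1 using 1; ring
    refine ⟨?_, ?_, ?_⟩
    · rw [hF1 b h'.lt.le, hb]; push_cast; rfl
    · rw [hF1 b' le_rfl, hb']; push_cast; rfl
    · rw [evalOrd_of_map_eq_conjProd hF]
      refine (Finset.sum_le_sum fun j _ => order_cut_sub_rescale_le hω hn h h' j).trans ?_
      rw [hper, hb']; push_cast; rfl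

end Key

/-! ### The valuations of the test -/

/-- The valuation `v` of the test is the one attached to `α` and to the exponent `b`. -/
structure IsState (n : ℕ) (hn : n ≠ 0) (α : K⟦X⟧) (e N b : ℕ) (v : K⟦X⟧[X] → ℕ∞) : Prop where
  level : IsLevel n α e N b
  val : ∀ G, (N : ℕ∞) * v G = shiftVal n hn α b G
  low : ∀ G : K⟦X⟧[X], G.degree < e → shiftVal n hn α b G = evalOrd n hn α G

/-- The values of a key polynomial for the next valuation. -/
structure IsKey (n : ℕ) (hn : n ≠ 0) (α : K⟦X⟧) (e b b' R : ℕ) (ψ : K⟦X⟧[X]) : Prop where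
  monic : ψ.Monic
  natDegree : ψ.natDegree = e
  shiftVal_left : shiftVal n hn α b ψ = (b + R : ℕ)
  shiftVal_right : shiftVal n hn α b' ψ = (b' + R : ℕ)
  evalOrd_self : evalOrd n hn α ψ = (b' + R : ℕ)
  lt_evalOrd_cut : (b' + R : ℕ) < evalOrd n hn (cut b' α) ψ

theorem lt_evalOrd_sum {n : ℕ} {hn : n ≠ 0} {α : K⟦X⟧} {ι : Type*} (s : Finset ι)
    (f : ι → K⟦X⟧[X]) {a : ℕ∞} (ha : a ≠ ⊤) (h : ∀ i ∈ s, a < evalOrd n hn α (f i)) :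
    a < evalOrd n hn α (∑ i ∈ s, f i) := by
  classical
  induction s using Finset.induction_on with
  | empty => rw [Finset.sum_empty, evalOrd_zero]; exact lt_top_iff_ne_top.2 ha
  | insert i s hi ih =>
    rw [Finset.sum_insert hi]
    exact (lt_min (h i (Finset.mem_insert_self i s))
      (ih fun j hj => h j (Finset.mem_insert_of_mem hj))).trans_le (min_le_evalOrd_add _ _)

theorem evalOrd_sum_eq {n : ℕ} {hn : n ≠ 0} {α : K⟦X⟧} {ι : Type*} (s : Finset ι)
    (f : ι → K⟦X⟧[X]) {i : ι} (hi : i ∈ s) (hfin : evalOrd n hn α (f i) ≠ ⊤)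
    (h : ∀ j ∈ s, j ≠ i → evalOrd n hn α (f i) < evalOrd n hn α (f j)) :
    evalOrd n hn α (∑ i ∈ s, f i) = evalOrd n hn α (f i) := by
  classical
  rw [← Finset.add_sum_erase s f hi]
  exact evalOrd_add_eq_left (lt_evalOrd_sum _ _ hfin fun j hj =>
    h j (Finset.mem_of_mem_erase hj) (Finset.ne_of_mem_erase hj))

section State
variable {n : ℕ} {hn : n ≠ 0} {α : K⟦X⟧} {e N b b' R : ℕ} {v : K⟦X⟧[X] → ℕ∞} {ψ : K⟦X⟧[X]}

theorem IsState.zero (n : ℕ) (hn : n ≠ 0) (α : K⟦X⟧) : IsState n hn α 1 n 0 initialVal where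
  level := IsLevel.zero α
  val G := (shiftVal_zero_right G).symm
  low G hG := by
    rw [shiftVal_zero_right]
    have h : G.degree ≤ 0 := by
      rcases eq_or_ne G 0 with rfl | h0
      · simp
      · rw [Polynomial.degree_eq_natDegree h0] at hG ⊢
        exact_mod_cast Nat.lt_one_iff.1 (by exact_mod_cast hG) |>.le
    rw [Polynomial.eq_C_of_degree_le_zero h, evalOrd, evalHom_C, order_expandHom]
    congr 1
    have := initialVal_C_add_C_mul_X (G.coeff 0) 0
    simpa using this

theorem IsState.ne_zero (h : IsState n hn α e N b v) : N ≠ 0 := by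
  rintro rfl
  exact hn (by rw [h.level.eq_mul, zero_mul])

theorem IsState.pos (h : IsState n hn α e N b v) : 0 < e :=
  Nat.pos_of_ne_zero (by rintro rfl; exact hn h.level.eq_mul)

/-- These divisibilities are the arithmetic heart of the argument: they separate values coming from
lower degree from those involving b'. -/
theorem IsState.dvd_of_shiftVal_eq (h : IsState n hn α e N b v) {G : K⟦X⟧[X]} {k : ℕ}
    (hk : shiftVal n hn α b G = k) : N ∣ k := by
  have h1 := h.val G
  rw [hk] at h1
  rcases eq_or_ne (v G) ⊤ with h2 | h2
  · rw [h2, ENat.mul_top (by exact_mod_cast h.ne_zero)] at h1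
    exact absurd h1 (by simp)
  · obtain ⟨l, hl⟩ := ENat.ne_top_iff_exists.1 h2
    rw [← hl] at h1
    exact ⟨l, by exact_mod_cast h1.symm⟩

theorem IsState.dvd_of_evalOrd_eq (h : IsState n hn α e N b v) {G : K⟦X⟧[X]} {k : ℕ}
    (hG : G.degree < e) (hk : evalOrd n hn α G = k) : N ∣ k :=
  h.dvd_of_shiftVal_eq (G := G) ((h.low G hG).trans hk)

theorem X_pow_succ_dvd_cut_sub (h : b < b') : PowerSeries.X ^ (b + 1) ∣ cut b' α - α :=
  (pow_dvd_pow _ h).trans (X_pow_dvd_cut_sub b' α)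

theorem IsState.evalOrd_cut (h : IsState n hn α e N b v) (hb : b < b') {G : K⟦X⟧[X]}
    (hG : G.degree < e) : evalOrd n hn (cut b' α) G = evalOrd n hn α G :=
  evalOrd_eq_of_shiftVal_eq (h.low G hG) (X_pow_succ_dvd_cut_sub hb)

theorem IsState.low' (h : IsState n hn α e N b v) (hb : b < b') {G : K⟦X⟧[X]}
    (hG : G.degree < e) : shiftVal n hn α b' G = evalOrd n hn α G :=
  shiftVal_eq_evalOrd_of_le hb.le (h.low G hG)

/-- Being a key polynomial only depends on leading behaviour, so a perturbation of lower degree and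
larger order is harmless. It serves both for the Tschirnhausen corrections and for comparing ψ with
the minimal polynomial of the truncation. -/
theorem IsKey.add (h : IsState n hn α e N b v) (hb : b < b') (hψ : IsKey n hn α e b b' R ψ)
    {δ : K⟦X⟧[X]} (hδ : δ.degree < e) (hlt : (b' + R : ℕ) < evalOrd n hn α δ) :
    IsKey n hn α e b b' R (ψ + δ) := by
  have hdeg : δ.degree < ψ.degree := by
    rw [Polynomial.degree_eq_natDegree hψ.monic.ne_zero, hψ.natDegree]; exact hδ
  have hbR : ((b + R : ℕ) : ℕ∞) < (b' + R : ℕ) := by exact_mod_cast Nat.add_lt_add_right hb R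
  refine ⟨hψ.monic.add_of_left hdeg, ?_, ?_, ?_, ?_, ?_⟩
  · rw [Polynomial.natDegree_add_eq_left_of_degree_lt hdeg, hψ.natDegree]
  · rw [shiftVal_add_eq_left, hψ.shiftVal_left]
    rw [hψ.shiftVal_left, h.low δ hδ]
    exact hbR.trans hlt
  · rw [shiftVal_add_eq_left, hψ.shiftVal_right]
    rw [hψ.shiftVal_right, h.low' hb hδ]
    exact hlt
  · rw [evalOrd_add_eq_left, hψ.evalOrd_self]
    rw [hψ.evalOrd_self]
    exact hlt
  · refine (lt_min hψ.lt_evalOrd_cut ?_).trans_le (min_le_evalOrd_add _ _)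
    rw [h.evalOrd_cut hb hδ]
    exact hlt

/-- Cancellation between a and ψH is excluded by specializing to the truncated series: there a keeps
its order, whereas ψ has order strictly larger than b' + R. -/
theorem IsKey.shiftVal_add_mul (h : IsState n hn α e N b v) (hb : b < b')
    (hψ : IsKey n hn α e b b' R ψ) {a : K⟦X⟧[X]} (ha : a.degree < e) (H : K⟦X⟧[X]) :
    shiftVal n hn α b' (a + ψ * H) =
      min (evalOrd n hn α a) ((b' + R : ℕ) + shiftVal n hn α b' H) := by
  have h1 : shiftVal n hn α b' (ψ * H) = (b' + R : ℕ) + shiftVal n hn α b' H := by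
    rw [shiftVal_mul, hψ.shiftVal_right]
  have h2 := h.low' hb ha
  have h3 := min_le_shiftVal_add (n := n) (hn := hn) (α := α) (b := b') a (ψ * H)
  rw [h1, h2] at h3
  refine le_antisymm ?_ h3
  rcases lt_or_ge ((b' + R : ℕ) + shiftVal n hn α b' H) (evalOrd n hn α a) with hlt | hge
  · rw [min_eq_right hlt.le, add_comm, shiftVal_add_eq_left, h1]
    rw [h1, h2]; exact hlt
  · rw [min_eq_left hge]
    rcases eq_or_ne (evalOrd n hn α a) ⊤ with htop | htop
    · rw [htop]; exact le_top
    have hcut : PowerSeries.X ^ b' ∣ cut b' α - α := X_pow_dvd_cut_sub b' α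
    refine (shiftVal_le_evalOrd (n := n) (hn := hn) hcut _).trans ?_
    rw [evalOrd_add_eq_left, h.evalOrd_cut hb ha]
    rw [h.evalOrd_cut hb ha, evalOrd_mul]
    have h4 := shiftVal_le_evalOrd (n := n) (hn := hn) hcut H
    rcases eq_or_ne (shiftVal n hn α b' H) ⊤ with hH | hH
    · rw [hH, top_le_iff] at h4
      rw [h4, add_top]
      exact lt_top_iff_ne_top.2 htop
    · refine hge.trans_lt (lt_of_lt_of_le ?_ (add_le_add_right h4 _))
      exact (ENat.add_lt_add_iff_right hH).2 hψ.lt_evalOrd_cut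

/-- Repeated division by ψ, with `IsKey.shiftVal_add_mul` at each stage. This is what turns the
formula defining the next valuation into a geometric one. -/
theorem IsKey.shiftVal_eq_iInf (h : IsState n hn α e N b v) (hb : b < b')
    (hψ : IsKey n hn α e b b' R ψ) (G : K⟦X⟧[X]) :
    shiftVal n hn α b' G =
      ⨅ i : ℕ, (evalOrd n hn α (adicCoeff ψ G i) + (i : ℕ∞) * (b' + R : ℕ)) := by
  have hψd : ψ.degree = e := by
    rw [Polynomial.degree_eq_natDegree hψ.monic.ne_zero, hψ.natDegree]
  have he : 0 < e := h.pos
  induction hd : G.natDegree using Nat.strong_induction_on generalizing G with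
  | _ d ih =>
    have hmod : (G %ₘ ψ).degree < e := hψd ▸ Polynomial.degree_modByMonic_lt G hψ.monic
    have key : shiftVal n hn α b' (G /ₘ ψ) = ⨅ i : ℕ,
        (evalOrd n hn α (adicCoeff ψ (G /ₘ ψ) i) + (i : ℕ∞) * (b' + R : ℕ)) := by
      by_cases h0 : G /ₘ ψ = 0
      · rw [h0, shiftVal_zero]
        have : ∀ i, adicCoeff ψ (0 : K⟦X⟧[X]) i = 0 := fun i => by simp [adicCoeff]
        simp [this, evalOrd_zero]
      · refine ih _ ?_ _ rfl
        have h1 : ψ.degree ≤ G.degree := by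
          by_contra hlt
          exact h0 ((Polynomial.divByMonic_eq_zero_iff hψ.monic).2 (not_le.1 hlt))
        have h2 := Polynomial.natDegree_le_natDegree h1
        rw [Polynomial.natDegree_divByMonic _ hψ.monic]
        rw [hψ.natDegree] at h2 ⊢
        omega
    conv_lhs => rw [← Polynomial.modByMonic_add_div G ψ]
    rw [hψ.shiftVal_add_mul h hb hmod, key, ENat.add_iInf]
    rw [← inf_iInf_nat_succ (fun i : ℕ =>
      evalOrd n hn α (adicCoeff ψ G i) + (i : ℕ∞) * (b' + R : ℕ))]
    refine congrArg₂ min ?_ ?_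
    · simp [adicCoeff_zero]
    · refine iInf_congr fun i => ?_
      rw [adicCoeff_succ hψ.monic]
      push_cast
      ring

theorem IsKey.degree_adicCoeff_lt (hψ : IsKey n hn α e b b' R ψ) (G : K⟦X⟧[X]) (i : ℕ) :
    (adicCoeff ψ G i).degree < e := by
  have := Abhyankar.degree_adicCoeff_lt hψ.monic G i
  rwa [Polynomial.degree_eq_natDegree hψ.monic.ne_zero, hψ.natDegree] at this

theorem IsKey.dvd_R (h : IsState n hn α e N b v) (hψ : IsKey n hn α e b b' R ψ) : N ∣ R :=
  (Nat.dvd_add_right h.level.dvd).1 (h.dvd_of_shiftVal_eq hψ.shiftVal_left)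

theorem IsKey.shiftVal_adic (h : IsState n hn α e N b v) (hψ : IsKey n hn α e b b' R ψ)
    (G : K⟦X⟧[X]) (i : ℕ) :
    shiftVal n hn α b (adicCoeff ψ G i * ψ ^ i) =
      evalOrd n hn α (adicCoeff ψ G i) + (i : ℕ∞) * (b + R : ℕ) := by
  rw [shiftVal_mul, shiftVal_pow, h.low _ (hψ.degree_adicCoeff_lt G i), hψ.shiftVal_left]

theorem IsKey.evalOrd_adic (hψ : IsKey n hn α e b b' R ψ) (G : K⟦X⟧[X]) (i : ℕ) :
    evalOrd n hn α (adicCoeff ψ G i * ψ ^ i) =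
      evalOrd n hn α (adicCoeff ψ G i) + (i : ℕ∞) * (b' + R : ℕ) := by
  rw [evalOrd_mul, evalOrd_pow, hψ.evalOrd_self]

/-- Multiplying by g turns q v into N v, which is known, and i m into i (b' - b), which replaces b +
R by b' + R in each term. -/
theorem IsKey.val_next (h : IsState n hn α e N b v) {g q m : ℕ} (hq : N = g * q)
    (hg : g ≠ 0) (hm : b' = b + g * m) (hb : b < b') (hψ : IsKey n hn α e b b' R ψ)
    (G : K⟦X⟧[X]) :
    (g : ℕ∞) * nextVal v ψ q m G = shiftVal n hn α b' G := by
  rw [hψ.shiftVal_eq_iInf h hb, nextVal, ENat.mul_iInf_of_ne (by exact_mod_cast hg)]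
  refine iInf_congr fun i => ?_
  have h1 := h.val (adicCoeff ψ G i * ψ ^ i)
  rw [hψ.shiftVal_adic h] at h1
  rw [mul_add, ← mul_assoc, ← Nat.cast_mul, ← hq, h1, hm]
  push_cast
  ring

/-- N = g q divides R, so division by g leaves i c ≡ j c modulo q, with c invertible modulo q. -/
theorem mul_add_mul_eq_imp {N g q c R i j x y b' : ℕ} (hq : N = g * q) (hb' : b' = g * c)
    (hcop : Nat.Coprime q c) (hg : g ≠ 0) (hR : N ∣ R) (hi : i < q) (hj : j < q)
    (h : N * x + i * (b' + R) = N * y + j * (b' + R)) : i = j := by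
  have h1 : (i * c : ℤ) ≡ j * c [ZMOD q] := by
    obtain ⟨r, rfl⟩ := hR
    subst hq hb'
    have h2 : (g : ℤ) * (q * x + i * (c + q * r)) = g * (q * y + j * (c + q * r)) := by
      have : ((g * q * x + i * (g * c + g * q * r) : ℕ) : ℤ) =
        (g * q * y + j * (g * c + g * q * r) : ℕ) := by exact_mod_cast h
      push_cast at this
      linear_combination this
    have h3 := mul_left_cancel₀ (by exact_mod_cast hg) h2
    refine (Int.modEq_iff_dvd).2 ⟨x - y + i * r - j * r, ?_⟩
    linear_combination -h3
  have h4 : (i : ℤ) ≡ j [ZMOD q] := by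
    have := Int.ModEq.cancel_right_div_gcd (by have := hi.trans_le' (Nat.zero_le i); omega) h1
    rwa [show Int.gcd (q : ℤ) c = 1 from hcop, Nat.cast_one, Int.ediv_one] at this
  have h5 : i ≡ j [MOD q] := (Int.natCast_modEq_iff).1 h4
  exact Nat.ModEq.eq_of_lt_of_lt h5 hi hj

/-- For degree below q e only the indices i < q occur in the ψ-adic expansion. Their terms have
pairwise distinct finite orders, so the minimum is attained once and is the order of the sum. -/
theorem IsKey.low_next (h : IsState n hn α e N b v) {g q c : ℕ} (hq : N = g * q)
    (hg : g ≠ 0) (hb' : b' = g * c) (hcop : Nat.Coprime q c) (hb : b < b')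
    (hψ : IsKey n hn α e b b' R ψ) (G : K⟦X⟧[X]) (hG : G.degree < (q * e : ℕ)) :
    shiftVal n hn α b' G = evalOrd n hn α G := by
  by_cases hG0 : G = 0
  · rw [hG0, shiftVal_zero, evalOrd_zero]
  have hGn : G.natDegree < q * ψ.natDegree := by
    rw [hψ.natDegree]
    rwa [Polynomial.degree_eq_natDegree hG0, Nat.cast_lt] at hG
  set f : ℕ → ℕ∞ := fun i => evalOrd n hn α (adicCoeff ψ G i) + (i : ℕ∞) * (b' + R : ℕ) with hf
  have hV : shiftVal n hn α b' G = ⨅ i, f i := hψ.shiftVal_eq_iInf h hb G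
  obtain ⟨i, hi⟩ := ENat.exists_eq_iInf f
  by_cases htop : f i = ⊤
  · have h1 : shiftVal n hn α b' G = ⊤ := by rw [hV, ← hi, htop]
    have h2 := shiftVal_le_evalOrd_self (n := n) (hn := hn) (α := α) (b := b') G
    rw [h1] at h2 ⊢
    exact (top_le_iff.1 h2).symm
  have hrange : ∀ j, f j ≠ ⊤ → j < q := by
    intro j hj
    by_contra hlt
    refine hj ?_
    have : adicCoeff ψ G j = 0 := adicCoeff_eq_zero hψ.monic
      (hGn.trans_le (Nat.mul_le_mul_right _ (not_lt.1 hlt)))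
    simp [hf, this, evalOrd_zero]
  have hnat : ∀ j, f j ≠ ⊤ → ∃ x : ℕ, f j = (N * x + j * (b' + R) : ℕ) := by
    intro j hj
    have h1 : evalOrd n hn α (adicCoeff ψ G j) ≠ ⊤ := fun h2 => hj (by simp [hf, h2])
    obtain ⟨k, hk⟩ := ENat.ne_top_iff_exists.1 h1
    obtain ⟨x, rfl⟩ := h.dvd_of_evalOrd_eq (hψ.degree_adicCoeff_lt G j) hk.symm
    refine ⟨x, ?_⟩
    simp only [hf]
    rw [← hk]
    push_cast
    rfl
  have hlt : ∀ j, j ≠ i → f i < f j := by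
    intro j hj
    refine lt_of_le_of_ne (hi ▸ iInf_le f j) fun heq => hj ?_
    have htop' : f j ≠ ⊤ := heq ▸ htop
    obtain ⟨x, hx⟩ := hnat i htop
    obtain ⟨y, hy⟩ := hnat j htop'
    rw [hx, hy] at heq
    exact (mul_add_mul_eq_imp hq hb' hcop hg (hψ.dvd_R h) (hrange i htop)
      (hrange j htop') (by exact_mod_cast heq)).symm
  have hord : ∀ j, evalOrd n hn α (adicCoeff ψ G j * ψ ^ j) = f j := hψ.evalOrd_adic G
  rw [hV, ← hi]
  conv_rhs => rw [eq_sum_adicCoeff hψ.monic hGn]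
  rw [evalOrd_sum_eq (Finset.range q) _ (Finset.mem_range.2 (hrange i htop))
    (by rw [hord]; exact htop) (fun j _ hj => by rw [hord, hord]; exact hlt j hj), hord]

/-- One step of the test. -/
theorem IsState.next (h : IsState n hn α e N b v) (h' : IsNextExponent α N b b')
    (hψ : IsKey n hn α e b b' R ψ) {g q m : ℕ} (hq : N = g * q)
    (hm : b' = b + g * m) (hcop : Nat.Coprime q m) :
    IsState n hn α (q * e) g b' (nextVal v ψ q m) := by
  have hg0 : g ≠ 0 := by rintro rfl; exact h.ne_zero (by rw [hq, zero_mul])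
  obtain ⟨c, hc⟩ := h.level.dvd
  have hbc : b' = g * (q * c + m) := by rw [hm, hc, hq]; ring
  have hcop' : Nat.Coprime q (q * c + m) := by
    rw [Nat.add_comm]; exact (Nat.coprime_add_mul_left_right q m c).2 hcop
  have hg : g = Nat.gcd N b' := by
    rw [hbc, hq, Nat.gcd_mul_left, Nat.Coprime.gcd_eq_one hcop', mul_one]
  exact ⟨h.level.next hn h' hg hq, hψ.val_next h hq hg0 hm h'.lt,
    fun G hG => hψ.low_next h hq hg0 hbc hcop' h'.lt G (by exact_mod_cast hG)⟩

end State

/-! ### Newton polygons -/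

section Polygon
variable {v : K⟦X⟧[X] → ℕ∞} {ψ F : K⟦X⟧[X]}

theorem mem_newtonRegion {i k : ℕ} (h0 : adicCoeff ψ F i ≠ 0)
    (hk : v (adicCoeff ψ F i * ψ ^ i) = k) : ((i : ℝ), (k : ℝ)) ∈ newtonRegion v ψ F :=
  subset_convexHull ℝ _ ⟨i, k, h0, hk, le_rfl, le_rfl⟩

theorem mem_line_of_mem_segment {a μ : ℝ} {p₀ p p' : ℝ × ℝ} (hp : p ∈ segment ℝ (0, a) p₀)
    (hp' : p' ∈ segment ℝ (0, a) p₀) (hlt : p.1 < p'.1) (hμ : p.2 - p'.2 = μ * (p'.1 - p.1))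
    {r : ℝ × ℝ} (hr : r ∈ segment ℝ (0, a) p₀) : r.2 = a - μ * r.1 := by
  rw [segment_eq_image] at hp hp' hr
  obtain ⟨s, -, rfl⟩ := hp
  obtain ⟨t, -, rfl⟩ := hp'
  obtain ⟨w, -, rfl⟩ := hr
  obtain ⟨x, y⟩ := p₀
  simp only [Prod.smul_mk, smul_eq_mul, mul_zero, Prod.mk_add_mk, zero_add] at hlt hμ ⊢
  have hst : t - s ≠ 0 := by
    intro h
    have : t = s := by linarith
    rw [this] at hlt
    exact lt_irrefl _ hlt
  have h1 : (t - s) * (a - y - μ * x) = 0 := by linear_combination hμ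
  have h2 := (mul_eq_zero.1 h1).resolve_left hst
  linear_combination (-w) * h2

/-- What passing one round of the test says about the Newton polygon. -/
theorem newtonPolygon_of_pass {N vF : ℕ} (hN : 0 < N) (hzero : ∀ i, N < i → adicCoeff ψ F i = 0)
    (hP : ((N : ℝ), (vF : ℝ)) ∈ newtonPolygon v ψ F) (hs : IsStraight (newtonPolygon v ψ F))
    (hq : 1 < (negSlope (newtonPolygon v ψ F)).den) :
    ∃ A : ℕ, adicCoeff ψ F 0 ≠ 0 ∧ v (adicCoeff ψ F 0 * ψ ^ 0) = A ∧
      (negSlope (newtonPolygon v ψ F)).den * A = (negSlope (newtonPolygon v ψ F)).den * vF +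
        N * (negSlope (newtonPolygon v ψ F)).num.toNat ∧
      0 < (negSlope (newtonPolygon v ψ F)).num.toNat ∧
      (∀ i k : ℕ, adicCoeff ψ F i ≠ 0 → v (adicCoeff ψ F i * ψ ^ i) = k →
        (negSlope (newtonPolygon v ψ F)).den * A ≤ (negSlope (newtonPolygon v ψ F)).den * k +
          i * (negSlope (newtonPolygon v ψ F)).num.toNat) ∧
      v (adicCoeff ψ F N * ψ ^ N) = vF := by
  set P := newtonPolygon v ψ F with hPdef
  set μ := negSlope P with hμdef
  -- Without a slope, `negSlope` takes its default value 0, whose denominator is 1.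
  have hex : ∃ μ : ℚ, HasNegSlope P μ := by
    by_contra hcon
    rw [hμdef, negSlope, dif_neg hcon] at hq
    simp at hq
  have hμ : HasNegSlope P μ := by
    rw [hμdef, negSlope, dif_pos hex]; exact hex.choose_spec
  obtain ⟨p, hp, p', hp', hlt, hslope⟩ := hμ
  obtain ⟨a, p₀, hseg⟩ : ∃ (a : ℝ) (p : ℝ × ℝ), P = segment ℝ (0, a) p := by
    rcases hs with ⟨r, hr⟩ | h
    · rw [hr] at hp hp'
      rw [hp, hp'] at hlt
      exact absurd hlt (lt_irrefl _)
    · exact h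
  have hline : ∀ r ∈ P, r.2 = a - μ * r.1 := fun r hr =>
    mem_line_of_mem_segment (hseg ▸ hp) (hseg ▸ hp') hlt hslope (hseg ▸ hr)
  -- The polygon consists of minimal points, hence is an antichain: moving right forces moving down.
  have hμpos : (0 : ℝ) < μ := by
    by_contra hneg
    have h1 : p.2 ≤ p'.2 := by nlinarith
    have h2 : p' ≤ p := hp'.2 hp.1 ⟨hlt.le, h1⟩
    exact absurd h2.1 (not_le.2 hlt)
  have h0P : ((0 : ℝ), a) ∈ P := hseg ▸ left_mem_segment ℝ _ _
  have hNline : (vF : ℝ) = a - μ * N := hline _ hP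
  have hNpos : (0 : ℝ) < N := by exact_mod_cast hN
  have hmemP : ∀ i : ℕ, i ≤ N → ((i : ℝ), a - μ * i) ∈ P := by
    intro i hi
    have hi' : (i : ℝ) ≤ N := by exact_mod_cast hi
    have hconv : Convex ℝ P := hseg ▸ convex_segment _ _
    have := hconv h0P hP (a := 1 - i / N) (b := i / N)
      (sub_nonneg.2 ((div_le_one hNpos).2 hi')) (by positivity) (by ring)
    convert this using 1
    simp only [Prod.smul_mk, smul_eq_mul, Prod.mk_add_mk, hNline]
    congr 1 <;> field_simp <;> ring
  have hle : ∀ i k : ℕ, adicCoeff ψ F i ≠ 0 → v (adicCoeff ψ F i * ψ ^ i) = k →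
      i ≤ N ∧ a - μ * i ≤ k := by
    intro i k h0 hk
    have hi : i ≤ N := by
      by_contra hcon
      exact h0 (hzero i (not_le.1 hcon))
    refine ⟨hi, ?_⟩
    by_contra hcon
    have := (hmemP i hi).2 (mem_newtonRegion h0 hk) ⟨le_rfl, (not_le.1 hcon).le⟩
    exact hcon this.2
  -- the end point on the vertical axis
  obtain ⟨A, hA0, hA, hAa⟩ : ∃ A : ℕ, adicCoeff ψ F 0 ≠ 0 ∧
      v (adicCoeff ψ F 0 * ψ ^ 0) = A ∧ (A : ℝ) ≤ a := by
    -- A convex combination with positive weights of points of abscissa ≥ 0 lies on the axis only if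
    -- both points do. So the axis part of the region comes from c_0 alone.
    have hC : Convex ℝ {r : ℝ × ℝ | 0 ≤ r.1 ∧ (r.1 = 0 → ∃ A : ℕ, adicCoeff ψ F 0 ≠ 0 ∧
        v (adicCoeff ψ F 0 * ψ ^ 0) = A ∧ (A : ℝ) ≤ r.2)} := by
      refine convex_iff_forall_pos.2 fun x hx y hy s t hs ht hst => ⟨?_, fun h => ?_⟩
      · have h1 := mul_nonneg hs.le hx.1
        have h2 := mul_nonneg ht.le hy.1
        simpa using add_nonneg h1 h2
      · have h1 := mul_nonneg hs.le hx.1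
        have h2 := mul_nonneg ht.le hy.1
        have h3 : s * x.1 + t * y.1 = 0 := by simpa using h
        have hx0 : x.1 = 0 := (mul_eq_zero.1 (by linarith : s * x.1 = 0)).resolve_left hs.ne'
        have hy0 : y.1 = 0 := (mul_eq_zero.1 (by linarith : t * y.1 = 0)).resolve_left ht.ne'
        obtain ⟨A, hA0, hA, hAx⟩ := hx.2 hx0
        obtain ⟨A', -, hA', hAy⟩ := hy.2 hy0
        have : A' = A := by rw [hA] at hA'; exact_mod_cast hA'.symm
        subst this
        refine ⟨A', hA0, hA, ?_⟩
        have h4 : (A' : ℝ) = s * A' + t * A' := by rw [← add_mul, hst, one_mul]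
        simp only [Prod.snd_add, Prod.smul_snd, smul_eq_mul]
        rw [h4]
        gcongr
    have hsub : newtonRegion v ψ F ⊆ _ := convexHull_min (by
      rintro r ⟨i, k, h0, hk, hi, hkr⟩
      refine ⟨(Nat.cast_nonneg i).trans hi, fun hr => ?_⟩
      have hi0 : i = 0 := by
        rw [hr] at hi
        exact_mod_cast le_antisymm hi (Nat.cast_nonneg i)
      subst hi0
      exact ⟨k, h0, hk, hkr⟩) hC
    exact (hsub h0P.1).2 rfl
  have hAeq : (A : ℝ) = a := le_antisymm hAa (by simpa using (hle 0 A hA0 hA).2)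
  have htop : v (adicCoeff ψ F N * ψ ^ N) = vF := by
    by_contra hcon
    -- Same principle on the supporting line: if c_N did not reach it at abscissa N, every point of
    -- the region on the line would have abscissa less than N, against `hP`.
    have hC : Convex ℝ {r : ℝ × ℝ | a ≤ r.2 + μ * r.1 ∧ (r.2 + μ * r.1 = a → r.1 < N)} := by
      refine convex_iff_forall_pos.2 fun x hx y hy s t hs ht hst => ?_
      have h1 := mul_le_mul_of_nonneg_left hx.1 hs.le
      have h2 := mul_le_mul_of_nonneg_left hy.1 ht.le
      have h3 : s * a + t * a = a := by rw [← add_mul, hst, one_mul]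
      simp only [Set.mem_ofPred_eq, Prod.snd_add, Prod.smul_snd, Prod.fst_add, Prod.smul_fst,
        smul_eq_mul]
      refine ⟨by nlinarith, fun h => ?_⟩
      have h4 : s * (x.2 + μ * x.1 - a) + t * (y.2 + μ * y.1 - a) = 0 := by
        linear_combination h - h3
      have h5 := mul_nonneg hs.le (sub_nonneg.2 hx.1)
      have h6 := mul_nonneg ht.le (sub_nonneg.2 hy.1)
      have hx0 := (mul_eq_zero.1 (by linarith : s * (x.2 + μ * x.1 - a) = 0)).resolve_left hs.ne'
      have hy0 := (mul_eq_zero.1 (by linarith : t * (y.2 + μ * y.1 - a) = 0)).resolve_left ht.ne'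
      have h7 := mul_lt_mul_of_pos_left (hx.2 (by linarith)) hs
      have h8 := mul_lt_mul_of_pos_left (hy.2 (by linarith)) ht
      have h9 : s * (N : ℝ) + t * N = N := by rw [← add_mul, hst, one_mul]
      linarith
    have hsub : newtonRegion v ψ F ⊆ _ := convexHull_min (by
      rintro r ⟨i, k, h0, hk, hi, hkr⟩
      obtain ⟨hiN, hik⟩ := hle i k h0 hk
      have h1 : (μ : ℝ) * i ≤ μ * r.1 := mul_le_mul_of_nonneg_left hi hμpos.le
      refine ⟨by linarith, fun hr => ?_⟩
      have h2 : (μ : ℝ) * i = μ * r.1 := by linarith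
      have h3 : (i : ℝ) = r.1 := mul_left_cancel₀ hμpos.ne' h2
      rw [← h3, Nat.cast_lt]
      refine lt_of_le_of_ne hiN ?_
      rintro rfl
      refine hcon ?_
      rw [hk]
      have : (k : ℝ) = vF := by linarith
      exact_mod_cast this) hC
    exact absurd ((hsub hP.1).2 (by simp only; linarith)) (lt_irrefl _)
  have hμnum : 0 < μ.num := Rat.num_pos.2 (by exact_mod_cast hμpos)
  have hnum : ((μ.num.toNat : ℕ) : ℝ) = μ * μ.den := by
    have h1 : ((μ.num.toNat : ℕ) : ℤ) = μ.num := Int.toNat_of_nonneg hμnum.le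
    have h2 : (μ.num : ℚ) = μ * μ.den := (Rat.mul_den_eq_num μ).symm
    have h3 : (μ.num : ℝ) = μ * μ.den := by exact_mod_cast h2
    rw [← h3]
    exact_mod_cast congrArg (Int.cast : ℤ → ℝ) h1
  have hden : (0 : ℝ) < μ.den := by exact_mod_cast μ.den_pos
  refine ⟨A, hA0, hA, ?_, by omega, fun i k h0 hk => ?_, htop⟩
  · have : (μ.den : ℝ) * A = μ.den * vF + N * μ.num.toNat := by
      rw [hnum, hAeq, hNline]; ring
    exact_mod_cast this
  · have h1 := (hle i k h0 hk).2
    have : (μ.den : ℝ) * A ≤ μ.den * k + i * μ.num.toNat := by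
      rw [hnum, hAeq]
      nlinarith
    exact_mod_cast this

/-- The region lies in the intersection of the half planes x ≥ 0, y ≥ B and the one above the line
through the two end points; the minimal points of that intersection form the segment. -/
theorem newtonPolygon_eq_segment {N A B : ℕ} (hN : 0 < N) (hAB : B < A)
    (hzero : ∀ i, N < i → adicCoeff ψ F i = 0)
    (h0 : adicCoeff ψ F 0 ≠ 0) (hA : v (adicCoeff ψ F 0 * ψ ^ 0) = A)
    (hN0 : adicCoeff ψ F N ≠ 0) (hB : v (adicCoeff ψ F N * ψ ^ N) = B)
    (hle : ∀ i k : ℕ, adicCoeff ψ F i ≠ 0 → v (adicCoeff ψ F i * ψ ^ i) = k →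
      N * A + i * B ≤ N * k + i * A) :
    newtonPolygon v ψ F = segment ℝ (0, (A : ℝ)) ((N : ℝ), (B : ℝ)) := by
  have hNpos : (0 : ℝ) < N := by exact_mod_cast hN
  have hAB' : (B : ℝ) < A := by exact_mod_cast hAB
  have hC : Convex ℝ {r : ℝ × ℝ | (0 ≤ r.1 ∧ (B : ℝ) ≤ r.2) ∧
      (N : ℝ) * A ≤ N * r.2 + (A - B) * r.1} := by
    refine Convex.inter (Convex.inter ?_ ?_) ?_
    · exact (convex_Ici (0 : ℝ)).linear_preimage (LinearMap.fst ℝ ℝ ℝ)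
    · exact (convex_Ici (B : ℝ)).linear_preimage (LinearMap.snd ℝ ℝ ℝ)
    · exact (convex_Ici ((N : ℝ) * A)).linear_preimage
        ((N : ℝ) • LinearMap.snd ℝ ℝ ℝ + ((A : ℝ) - B) • LinearMap.fst ℝ ℝ ℝ)
  have hsub : newtonRegion v ψ F ⊆ _ := convexHull_min (by
    rintro r ⟨i, k, hi0, hk, hi, hkr⟩
    have hiN : i ≤ N := by
      by_contra hcon
      exact hi0 (hzero i (not_le.1 hcon))
    have hiN' : (i : ℝ) ≤ N := by exact_mod_cast hiN
    have h1 : (N : ℝ) * A + i * B ≤ N * k + i * A := by exact_mod_cast hle i k hi0 hk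
    have h2 : (N : ℝ) * k ≤ N * r.2 := mul_le_mul_of_nonneg_left hkr hNpos.le
    have h3 : ((A : ℝ) - B) * i ≤ (A - B) * r.1 :=
      mul_le_mul_of_nonneg_left hi (sub_nonneg.2 hAB'.le)
    have h4 : ((A : ℝ) - B) * i ≤ (A - B) * N :=
      mul_le_mul_of_nonneg_left hiN' (sub_nonneg.2 hAB'.le)
    refine ⟨⟨(Nat.cast_nonneg i).trans hi, ?_⟩, by linarith⟩
    refine le_trans ?_ hkr
    refine le_of_mul_le_mul_left ?_ hNpos
    linarith) hC
  have hmem : segment ℝ (0, (A : ℝ)) ((N : ℝ), (B : ℝ)) ⊆ newtonRegion v ψ F := by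
    refine (convex_convexHull ℝ _).segment_subset ?_ (mem_newtonRegion hN0 hB)
    have h := mem_newtonRegion h0 hA
    rwa [Nat.cast_zero] at h
  have hpt : ∀ x : ℝ, 0 ≤ x → x ≤ N →
      (x, A - (A - B) / N * x) ∈ segment ℝ (0, (A : ℝ)) ((N : ℝ), (B : ℝ)) := by
    intro x hx hxN
    rw [segment_eq_image]
    refine ⟨x / N, ⟨by positivity, (div_le_one hNpos).2 hxN⟩, ?_⟩
    simp only [Prod.smul_mk, smul_eq_mul, Prod.mk_add_mk]
    congr 1 <;> field_simp <;> ring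
  ext p
  constructor
  · intro hp
    obtain ⟨⟨hx, hy⟩, hl⟩ := hsub hp.1
    -- A point of the region dominates the point of the segment with the same abscissa, or else its
    -- right end.
    rcases le_or_gt p.1 N with hxN | hxN
    · have h1 := hpt p.1 hx hxN
      have h2 : (p.1, (A : ℝ) - (A - B) / N * p.1) ≤ p := by
        refine ⟨le_rfl, ?_⟩
        simp only
        rw [sub_le_iff_le_add]
        refine le_of_mul_le_mul_left ?_ hNpos
        have : (N : ℝ) * (p.2 + (A - B) / N * p.1) = N * p.2 + (A - B) * p.1 := by
          field_simp
        rw [this]; exact hl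
      have h3 := hp.2 (hmem h1) h2
      exact (le_antisymm h2 h3 : _ = p) ▸ h1
    · have h1 : ((N : ℝ), (B : ℝ)) ≤ p := ⟨hxN.le, hy⟩
      have h3 := hp.2 (mem_newtonRegion hN0 hB) h1
      exact absurd h3.1 (not_le.2 hxN)
  · intro hp
    refine ⟨hmem hp, fun r hr hrp => ?_⟩
    obtain ⟨⟨-, -⟩, hl⟩ := hsub hr
    have hpl : (N : ℝ) * p.2 + (A - B) * p.1 = N * A := by
      rw [segment_eq_image] at hp
      obtain ⟨t, -, rfl⟩ := hp
      simp only [Prod.smul_mk, smul_eq_mul, Prod.mk_add_mk]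
      ring
    have h1 : 0 ≤ (N : ℝ) * (p.2 - r.2) := mul_nonneg hNpos.le (sub_nonneg.2 hrp.2)
    have h2 : 0 ≤ ((A : ℝ) - B) * (p.1 - r.1) :=
      mul_nonneg (sub_nonneg.2 hAB'.le) (sub_nonneg.2 hrp.1)
    constructor
    · refine le_of_mul_le_mul_left ?_ (sub_pos.2 hAB')
      linarith
    · refine le_of_mul_le_mul_left ?_ hNpos
      linarith

theorem negSlope_segment {N A B : ℕ} (hN : 0 < N) :
    negSlope (segment ℝ (0, (A : ℝ)) ((N : ℝ), (B : ℝ))) = ((A : ℚ) - B) / N := by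
  have hNpos : (0 : ℝ) < N := by exact_mod_cast hN
  have hex : HasNegSlope (segment ℝ (0, (A : ℝ)) ((N : ℝ), (B : ℝ))) (((A : ℚ) - B) / N) := by
    refine ⟨_, left_mem_segment ℝ _ _, _, right_mem_segment ℝ _ _, hNpos, ?_⟩
    push_cast
    field_simp
    ring
  have hex' : ∃ μ : ℚ, HasNegSlope (segment ℝ (0, (A : ℝ)) ((N : ℝ), (B : ℝ))) μ := ⟨_, hex⟩
  rw [negSlope, dif_pos hex']
  obtain ⟨p, hp, p', hp', hlt, hslope⟩ := hex'.choose_spec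
  have h1 := mem_line_of_mem_segment hp hp' hlt hslope (right_mem_segment ℝ _ _)
  simp only at h1
  have h2 : ((hex'.choose : ℚ) : ℝ) = ((A : ℝ) - B) / N := by
    field_simp
    linarith
  exact_mod_cast h2

end Polygon

/-! ### Puiseux series -/

section Puiseux

theorem mem_maximalIdeal_iff {f : K⟦X⟧} :
    f ∈ IsLocalRing.maximalIdeal K⟦X⟧ ↔ PowerSeries.constantCoeff f = 0 := by
  rw [PowerSeries.maximalIdeal_eq_span_X, Ideal.mem_span_singleton, PowerSeries.X_dvd_iff]

/-- A form of Hensel's lemma: splitting off the roots of `H(0, y)` which vanish. -/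
theorem exists_monic_factor {H : K⟦X⟧[X]} (hH : H.Monic) {r : ℕ}
    (hlt : ∀ i < r, PowerSeries.constantCoeff (H.coeff i) = 0)
    (hr : PowerSeries.constantCoeff (H.coeff r) ≠ 0) :
    ∃ P Q : K⟦X⟧[X], H = P * Q ∧ P.Monic ∧ Q.Monic ∧ P.natDegree = r := by
  have : IsAdicComplete (IsLocalRing.maximalIdeal K⟦X⟧) K⟦X⟧ := by
    rw [PowerSeries.maximalIdeal_eq_span_X]; infer_instance
  set g : K⟦X⟧⟦X⟧ := (H : K⟦X⟧⟦X⟧) with hg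
  have hord : (g.map (IsLocalRing.residue K⟦X⟧)).order = r := by
    rw [PowerSeries.order_eq_nat]
    simp only [hg, PowerSeries.coeff_map, Polynomial.coeff_coe]
    refine ⟨?_, fun i hi => ?_⟩
    · rw [ne_eq, IsLocalRing.residue_eq_zero_iff, mem_maximalIdeal_iff]; exact hr
    · rw [IsLocalRing.residue_eq_zero_iff, mem_maximalIdeal_iff]; exact hlt i hi
  have hne : g.map (IsLocalRing.residue K⟦X⟧) ≠ 0 := by
    intro h; rw [h, PowerSeries.order_zero] at hord; exact absurd hord (by simp)
  -- Weierstrass preparation in K[[x]][[y]]; the cofactor is a priori only a power series in y.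
  obtain ⟨P, h, hPh⟩ := PowerSeries.exists_isWeierstrassFactorization hne
  have hPm := hPh.isDistinguishedAt.monic
  have hPd : P.natDegree = r := by rw [hPh.natDegree_eq_toNat_order_map, hord]; simp
  have hPo : ((P : K⟦X⟧⟦X⟧).map (Ideal.Quotient.mk (IsLocalRing.maximalIdeal K⟦X⟧))).order.toNat =
      P.natDegree := by
    have h1 := hPh.isDistinguishedAt.coe_natDegree_eq_order_map (P : K⟦X⟧⟦X⟧) 1
      (by rw [map_one, mem_maximalIdeal_iff]; simp) (by simp)
    rw [← h1]; simp
  have hdiv := hPh.isDistinguishedAt.isWeierstrassDivisorAt'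
  have hR : (H %ₘ P).degree <
      ((P : K⟦X⟧⟦X⟧).map (Ideal.Quotient.mk (IsLocalRing.maximalIdeal K⟦X⟧))).order.toNat := by
    rw [hPo, ← Polynomial.degree_eq_natDegree hPm.ne_zero]
    exact Polynomial.degree_modByMonic_lt H hPm
  have heq : (P : K⟦X⟧⟦X⟧) * ((H /ₘ P : K⟦X⟧[X]) : K⟦X⟧⟦X⟧) + ((H %ₘ P : K⟦X⟧[X]) : K⟦X⟧⟦X⟧) =
      P * h + ((0 : K⟦X⟧[X]) : K⟦X⟧⟦X⟧) := by
    rw [Polynomial.coe_zero, add_zero, ← hPh.eq_mul, hg, ← Polynomial.coe_mul,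
      ← Polynomial.coe_add, add_comm, Polynomial.modByMonic_add_div]
  -- Polynomial division by P is also a Weierstrass division, so by uniqueness its remainder
  -- vanishes and the cofactor is a polynomial.
  have hzero := (hdiv.eq_of_mul_add_eq_mul_add hR (by simp) heq).2
  have hmul : H = P * (H /ₘ P) := by
    conv_lhs => rw [← Polynomial.modByMonic_add_div H P, hzero, zero_add]
  exact ⟨P, H /ₘ P, hmul, hPm, hPm.of_mul_monic_left (hmul ▸ hH), hPd⟩

theorem expandHom_mul (s M : ℕ) (hs : s ≠ 0) (hM : M ≠ 0) (f : K⟦X⟧) :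
    expandHom M hM (expandHom s hs f) = expandHom (M * s) (Nat.mul_ne_zero hM hs) f :=
  (PowerSeries.expand_mul M hM s hs f).symm

theorem evalHom_taylor {M : ℕ} (hM : M ≠ 0) (γ c : K⟦X⟧) (F : K⟦X⟧[X]) :
    evalHom M hM γ (Polynomial.taylor c F) = evalHom M hM (γ + expandHom M hM c) F := by
  simp [evalHom, Polynomial.taylor_apply, Polynomial.eval₂_comp]

theorem monic_taylor {F : K⟦X⟧[X]} (hF : F.Monic) (c : K⟦X⟧) : (Polynomial.taylor c F).Monic := by
  rw [Polynomial.taylor_apply]; exact hF.comp_X_add_C c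

/-- Splitting a monic polynomial whose reduction is not a power of a linear form. -/
theorem exists_taylor_eq_mul [IsAlgClosed K] {H : K⟦X⟧[X]} (hH : H.Monic)
    (hd : (H.natDegree : K) ≠ 0)
    (h1 : PowerSeries.constantCoeff (H.coeff (H.natDegree - 1)) = 0)
    (h2 : ∃ i < H.natDegree, PowerSeries.constantCoeff (H.coeff i) ≠ 0) :
    ∃ (c : K⟦X⟧) (P Q : K⟦X⟧[X]), Polynomial.taylor c H = P * Q ∧ P.Monic ∧ Q.Monic ∧
      P.natDegree < H.natDegree ∧ Q.natDegree < H.natDegree := by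
  set d := H.natDegree with hdd
  have hd0 : d ≠ 0 := by rintro h; rw [h] at hd; simp at hd
  set h₀ : K[X] := H.map PowerSeries.constantCoeff with hh₀
  have hm : h₀.Monic := hH.map _
  have hdeg : h₀.natDegree = d := hH.natDegree_map _
  obtain ⟨c, hc⟩ := IsAlgClosed.exists_root h₀ (by
    rw [Polynomial.degree_eq_natDegree hm.ne_zero, hdeg]; exact_mod_cast hd0)
  set G := Polynomial.taylor (PowerSeries.C c) H with hG
  have hGm : G.Monic := monic_taylor hH _
  have hGd : G.natDegree = d := Polynomial.natDegree_taylor _ _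
  have hG₀ : G.map PowerSeries.constantCoeff = Polynomial.taylor c h₀ := by
    rw [hG, Polynomial.map_taylor]; simp [hh₀]
  have hcoef : ∀ i, PowerSeries.constantCoeff (G.coeff i) = (Polynomial.taylor c h₀).coeff i := by
    intro i; rw [← hG₀, Polynomial.coeff_map]
  have ht0 : (Polynomial.taylor c h₀).coeff 0 = 0 := by
    rw [Polynomial.taylor_coeff_zero]; exact hc
  have htd : (Polynomial.taylor c h₀).coeff d = 1 := by
    rw [← hcoef, ← hGd, hGm.coeff_natDegree, map_one]
  classical
  have hex : ∃ r, (Polynomial.taylor c h₀).coeff r ≠ 0 := ⟨d, by rw [htd]; exact one_ne_zero⟩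
  set r := Nat.find hex with hr
  have hrspec := Nat.find_spec hex
  have hrmin : ∀ i < r, (Polynomial.taylor c h₀).coeff i = 0 := fun i hi => by
    by_contra h; exact Nat.find_min hex hi h
  have hr0 : 0 < r := Nat.pos_of_ne_zero fun h => hrspec (by rw [← hr, h]; exact ht0)
  have hrd : r ≤ d := Nat.find_min' hex (by rw [htd]; exact one_ne_zero)
  -- Otherwise the reduction is (y - c)^d, whose second coefficient is -d c. As d is invertible,
  -- `h1` gives c = 0 and the reduction is y^d, contradicting `h2`.
  have hrne : r ≠ d := by
    intro hrd
    have hpow : Polynomial.taylor c h₀ = Polynomial.X ^ d := by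
      ext i
      rw [Polynomial.coeff_X_pow]
      split_ifs with hi
      · rw [hi, htd]
      · rcases lt_or_gt_of_ne hi with hi | hi
        · exact hrmin i (hrd ▸ hi)
        · exact Polynomial.coeff_eq_zero_of_natDegree_lt
            (by rw [Polynomial.natDegree_taylor, hdeg]; exact hi)
    have hh : h₀ = (Polynomial.X - Polynomial.C c) ^ d := by
      have h3 := congrArg (Polynomial.taylor (-c)) hpow
      rw [Polynomial.taylor_taylor, neg_add_cancel, Polynomial.taylor_zero] at h3
      rw [h3, Polynomial.taylor_apply]
      simp [sub_eq_add_neg]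
    have h4 : h₀.coeff (d - 1) = 0 := by rw [hh₀, Polynomial.coeff_map]; exact h1
    rw [hh, sub_eq_add_neg, ← Polynomial.C_neg, Polynomial.coeff_X_add_C_pow, Nat.sub_sub_self (Nat.one_le_iff_ne_zero.2 hd0), pow_one,
      Nat.choose_symm (Nat.one_le_iff_ne_zero.2 hd0), Nat.choose_one_right] at h4
    have hc0 : c = 0 := by
      simpa using (mul_eq_zero.1 h4).resolve_right hd
    obtain ⟨i, hi, hi0⟩ := h2
    refine hi0 ?_
    have : h₀.coeff i = 0 := by
      rw [hh, hc0, Polynomial.C_0, sub_zero, Polynomial.coeff_X_pow, if_neg hi.ne]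
    rwa [hh₀, Polynomial.coeff_map] at this
  obtain ⟨P, Q, hPQ, hP, hQ, hPd⟩ := exists_monic_factor hGm (r := r)
    (fun i hi => by rw [hcoef]; exact hrmin i hi) (by rw [hcoef]; exact hrspec)
  have hsum : d = r + Q.natDegree := by
    rw [← hPd, ← hP.natDegree_mul hQ, ← hPQ, hGd]
  exact ⟨_, P, Q, hPQ, hP, hQ, by omega, by omega⟩

/-- Removing the second highest coefficient. -/
theorem exists_taylor_eq_X_pow_add {F : K⟦X⟧[X]} (hF : F.Monic) (hd : (F.natDegree : K) ≠ 0) :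
    ∃ (c : K⟦X⟧) (S : K⟦X⟧[X]), Polynomial.taylor c F = Polynomial.X ^ F.natDegree + S ∧
      S.degree < ((F.natDegree - 1 : ℕ) : WithBot ℕ) := by
  have hd0 : F.natDegree ≠ 0 := fun h => hd (by rw [h]; simp)
  -- The approximate root of index deg F is linear; translating it to y removes the second
  -- coefficient.
  obtain ⟨h1, h2, h3⟩ := isApproxRoot_approxRoot hF hd dvd_rfl
  rw [Nat.div_self (Nat.pos_of_ne_zero hd0)] at h2 h3
  set ψ := approxRoot F F.natDegree
  have hψ : ψ = Polynomial.X + Polynomial.C (ψ.coeff 0) := h1.eq_X_add_C h2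
  refine ⟨-ψ.coeff 0, Polynomial.taylor (-ψ.coeff 0) (F - ψ ^ F.natDegree), ?_, ?_⟩
  · have h4 : Polynomial.taylor (-ψ.coeff 0) (ψ ^ F.natDegree) = Polynomial.X ^ F.natDegree := by
      rw [Polynomial.taylor_pow]
      congr 1
      rw [hψ]
      simp
    rw [map_sub, h4]
    ring
  · rw [Polynomial.degree_taylor]; exact h3

theorem evalHom_weighted {s M : ℕ} (hs : s ≠ 0) (hM : M ≠ 0) (r : ℕ) (γ : K⟦X⟧) (G : K⟦X⟧[X]) :
    evalHom (M * s) (Nat.mul_ne_zero hM hs) (expandHom M hM (PowerSeries.X ^ r) * γ) G =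
      evalHom M hM γ ((G.map (expandHom s hs)).eval₂ Polynomial.C
        (Polynomial.C (PowerSeries.X ^ r) * Polynomial.X)) := by
  have : evalHom (M * s) (Nat.mul_ne_zero hM hs) (expandHom M hM (PowerSeries.X ^ r) * γ) =
      ((evalHom M hM γ).comp (Polynomial.eval₂RingHom Polynomial.C
        (Polynomial.C (PowerSeries.X ^ r) * Polynomial.X))).comp
        (Polynomial.mapRingHom (expandHom s hs)) := by
    apply Polynomial.ringHom_ext
    · intro a; simp [evalHom, expandHom_mul]
    · simp only [RingHom.comp_apply, Polynomial.coe_mapRingHom, Polynomial.map_X,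
        Polynomial.coe_eval₂RingHom, Polynomial.eval₂_X, map_mul, evalHom_C, evalHom_X]
  exact congrArg (fun φ => φ G) this

/-- The Newton substitution `x = t ^ s`, `y = t ^ r * z`. -/
theorem exists_newton_subst {d : ℕ} {S : K⟦X⟧[X]} (hS : S ≠ 0)
    (hSd : S.degree < ((d - 1 : ℕ) : WithBot ℕ)) :
    ∃ (s r : ℕ) (hs : s ≠ 0) (H : K⟦X⟧[X]), H.Monic ∧ H.natDegree = d ∧ H.coeff (d - 1) = 0 ∧
      (∃ i < d, PowerSeries.constantCoeff (H.coeff i) ≠ 0) ∧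
      ((Polynomial.X ^ d + S).map (expandHom s hs)).eval₂ Polynomial.C
        (Polynomial.C (PowerSeries.X ^ r) * Polynomial.X) =
        Polynomial.C (PowerSeries.X ^ (r * d)) * H := by
  have hsupp : ∀ i ∈ S.support, i < d - 1 := fun i hi => by
    have h1 := Polynomial.le_degree_of_mem_supp i hi
    exact_mod_cast h1.trans_lt hSd
  -- The index i₀ minimizes ord(a_i) / (d - i) = r / s. All terms become divisible by t^(r d), and
  -- that of index i₀ exactly, so H has a unit coefficient there. The fraction r / s need not be
  -- reduced.
  obtain ⟨i₀, hi₀, hmin⟩ := Finset.exists_min_image S.support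
    (fun i => ((S.coeff i).order.toNat : ℚ) / ((d - i : ℕ) : ℚ))
    (Polynomial.support_nonempty.2 hS)
  have hi₀d := hsupp i₀ hi₀
  have hs : d - i₀ ≠ 0 := by omega
  set s := d - i₀ with hsdef
  set r := (S.coeff i₀).order.toNat with hrdef
  have hord : ∀ i ∈ S.support, ((S.coeff i).order.toNat : ℕ∞) = (S.coeff i).order := fun i hi =>
    ENat.natCast_toNat (by
      rw [ne_eq, PowerSeries.order_eq_top]; exact Polynomial.mem_support_iff.1 hi)
  have hle : ∀ i ∈ S.support, r * (d - i) ≤ s * (S.coeff i).order.toNat := by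
    intro i hi
    have h1 := hmin i hi
    have h2 : 0 < d - i := by have := hsupp i hi; omega
    rw [div_le_div_iff₀ (by exact_mod_cast Nat.pos_of_ne_zero hs) (by exact_mod_cast h2)] at h1
    have h3 : r * (d - i) ≤ (S.coeff i).order.toNat * s := by exact_mod_cast h1
    rwa [mul_comm s]
  have hex : ∀ i, ∃ b : K⟦X⟧, i ∈ S.support →
      expandHom s hs (S.coeff i) = PowerSeries.X ^ (r * (d - i)) * b := by
    intro i
    by_cases hi : i ∈ S.support
    · have h1 : ((r * (d - i) : ℕ) : ℕ∞) ≤ (expandHom s hs (S.coeff i)).order := by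
        rw [order_expandHom, ← hord i hi]
        exact_mod_cast hle i hi
      obtain ⟨b, hb⟩ := natCast_le_order_iff.1 h1
      exact ⟨b, fun _ => hb⟩
    · exact ⟨0, fun h => absurd h hi⟩
  choose B hB using hex
  set T : K⟦X⟧[X] := ∑ i ∈ S.support, Polynomial.C (B i) * Polynomial.X ^ i with hT
  have hTcoeff : ∀ i, T.coeff i = if i ∈ S.support then B i else 0 := by
    intro i
    rw [hT, Polynomial.finsetSum_coeff]
    simp only [Polynomial.coeff_C_mul_X_pow]
    rw [Finset.sum_ite_eq]
  have hTd : T.degree < ((d - 1 : ℕ) : WithBot ℕ) := by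
    rw [Polynomial.degree_lt_iff_coeff_zero]
    intro i hi
    rw [hTcoeff, if_neg fun h => absurd (hsupp i h) (not_lt.2 hi)]
  have hTd' : T.degree < (Polynomial.X ^ d : K⟦X⟧[X]).degree := by
    rw [Polynomial.degree_X_pow]
    exact hTd.trans_le (by exact_mod_cast Nat.sub_le d 1)
  refine ⟨s, r, hs, Polynomial.X ^ d + T, (Polynomial.monic_X_pow d).add_of_left hTd', ?_, ?_,
    ⟨i₀, by omega, ?_⟩, ?_⟩
  · rw [Polynomial.natDegree_add_eq_left_of_degree_lt hTd', Polynomial.natDegree_X_pow]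
  · rw [Polynomial.coeff_add, Polynomial.coeff_X_pow, if_neg (by omega), zero_add]
    exact Polynomial.coeff_eq_zero_of_degree_lt hTd
  · rw [Polynomial.coeff_add, Polynomial.coeff_X_pow, if_neg (by omega), zero_add, hTcoeff,
      if_pos hi₀]
    have h1 := congrArg PowerSeries.order (hB i₀ hi₀)
    rw [order_expandHom, PowerSeries.order_mul, PowerSeries.order_X_pow, ← hord i₀ hi₀] at h1
    intro h0
    have h2 : (B i₀).order ≠ 0 := PowerSeries.order_ne_zero_iff_constCoeff_eq_zero.2 h0
    have h3 : ((s * r : ℕ) : ℕ∞) + (B i₀).order = ((s * r : ℕ) : ℕ∞) + 0 := by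
      have : r * (d - i₀) = s * r := by rw [mul_comm]
      rw [this] at h1
      rw [← h1]; push_cast; rw [add_zero]
    exact h2 (WithTop.add_left_cancel (ENat.natCast_ne_top _) h3)
  · have h1 : (S.map (expandHom s hs)).eval₂ Polynomial.C
        (Polynomial.C (PowerSeries.X ^ r) * Polynomial.X) =
        Polynomial.C (PowerSeries.X ^ (r * d)) * T := by
      conv_lhs => rw [S.as_sum_support_C_mul_X_pow]
      rw [Polynomial.map_sum, Polynomial.eval₂_finsetSum, hT, Finset.mul_sum]
      refine Finset.sum_congr rfl fun i hi => ?_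
      have hid := hsupp i hi
      have hpow : r * d = r * (d - i) + r * i := by
        rw [← mul_add]; congr 1; omega
      rw [Polynomial.map_mul, Polynomial.map_C, hB i hi, Polynomial.map_pow, Polynomial.map_X,
        Polynomial.eval₂_mul, Polynomial.eval₂_C, Polynomial.eval₂_pow, Polynomial.eval₂_X, hpow,
        mul_pow, pow_add, pow_mul _ r i]
      simp only [Polynomial.C_mul, Polynomial.C_pow]
      ring
    rw [Polynomial.map_add, Polynomial.eval₂_add, h1, mul_add]
    congr 1
    simp only [Polynomial.map_pow, Polynomial.map_X, Polynomial.eval₂_pow, Polynomial.eval₂_X,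
      mul_pow, ← Polynomial.C_pow, pow_mul]

/-- Puiseux's theorem for polynomials of degree prime to the characteristic. -/
theorem exists_evalHom_eq_zero [IsAlgClosed K] {F : K⟦X⟧[X]} (hF : F.Monic)
    (hd : (F.natDegree : K) ≠ 0) : ∃ (M : ℕ) (hM : M ≠ 0) (γ : K⟦X⟧), evalHom M hM γ F = 0 := by
  induction hdd : F.natDegree using Nat.strong_induction_on generalizing F with
  | _ d ih =>
    subst hdd
    have hd0 : F.natDegree ≠ 0 := fun h => hd (by rw [h]; simp)
    obtain ⟨c, S, hS, hSd⟩ := exists_taylor_eq_X_pow_add hF hd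
    suffices ∃ (M : ℕ) (hM : M ≠ 0) (γ : K⟦X⟧), evalHom M hM γ (Polynomial.taylor c F) = 0 by
      obtain ⟨M, hM, γ, h⟩ := this
      exact ⟨M, hM, _, (evalHom_taylor hM γ c F) ▸ h⟩
    by_cases hS0 : S = 0
    · exact ⟨1, one_ne_zero, 0, by simp [hS, hS0, evalHom_X, hd0]⟩
    obtain ⟨s, r, hs, H, hH, hHd, hH1, hH2, hHeq⟩ := exists_newton_subst hS0 hSd
    suffices ∃ (M : ℕ) (hM : M ≠ 0) (γ : K⟦X⟧), evalHom M hM γ H = 0 by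
      obtain ⟨M, hM, γ, h⟩ := this
      refine ⟨M * s, Nat.mul_ne_zero hM hs, expandHom M hM (PowerSeries.X ^ r) * γ, ?_⟩
      rw [hS, evalHom_weighted hs hM r γ, hHeq, map_mul, h, mul_zero]
    obtain ⟨c', P, Q, hPQ, hP, hQ, hPd, hQd⟩ := exists_taylor_eq_mul hH (by rwa [hHd])
      (by rw [hHd, hH1, map_zero]) (by rwa [hHd])
    suffices ∃ (M : ℕ) (hM : M ≠ 0) (γ : K⟦X⟧), evalHom M hM γ (P * Q) = 0 by
      obtain ⟨M, hM, γ, h⟩ := this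
      rw [← hPQ, evalHom_taylor] at h
      exact ⟨M, hM, _, h⟩
    rw [hHd] at hPd hQd
    have hsum : P.natDegree + Q.natDegree = F.natDegree := by
      rw [← hP.natDegree_mul hQ, ← hPQ, Polynomial.natDegree_taylor, hHd]
    -- The two degrees add up to one that is nonzero in K, so at least one factor stays prime to the
    -- characteristic.
    by_cases hP0 : (P.natDegree : K) = 0
    · have hQ0 : (Q.natDegree : K) ≠ 0 := by
        intro hQ0
        refine hd ?_
        rw [← hsum, Nat.cast_add, hP0, hQ0, add_zero]
      obtain ⟨M, hM, γ, h⟩ := ih _ hQd hQ hQ0 rfl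
      exact ⟨M, hM, γ, by rw [map_mul, h, mul_zero]⟩
    · obtain ⟨M, hM, γ, h⟩ := ih _ hPd hP hP0 rfl
      exact ⟨M, hM, γ, by rw [map_mul, h, zero_mul]⟩

/-! ### Parametrization of irreducible polynomials -/

/-- Over an integrally closed domain the minimal polynomial of γ divides both F and G, and it is
associated to F by irreducibility. -/
theorem dvd_of_irreducible_of_eval₂ {A B : Type*} [CommRing A] [IsDomain A] [IsIntegrallyClosed A]
    [CommRing B] [IsDomain B] (f : A →+* B) (hf : Function.Injective f) {γ : B} {F G : A[X]}
    (hFm : F.Monic) (hF : Irreducible F) (h1 : F.eval₂ f γ = 0) (h2 : G.eval₂ f γ = 0) :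
    F ∣ G := by
  let := f.toAlgebra
  have : Module.IsTorsionFree A B := Module.isTorsionFree_iff_algebraMap_injective.2 hf
  have hint : IsIntegral A γ := ⟨F, hFm, h1⟩
  have h3 : minpoly A γ ∣ F := minpoly.isIntegrallyClosed_dvd hint h1
  have h4 : minpoly A γ ∣ G := minpoly.isIntegrallyClosed_dvd hint h2
  exact ((minpoly.irreducible hint).associated_of_dvd hF h3).symm.dvd.trans h4

theorem dvd_of_evalHom_eq_zero {M : ℕ} {hM : M ≠ 0} {γ : K⟦X⟧} {F G : K⟦X⟧[X]} (hFm : F.Monic)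
    (hF : Irreducible F) (h1 : evalHom M hM γ F = 0) (h2 : evalHom M hM γ G = 0) : F ∣ G :=
  dvd_of_irreducible_of_eval₂ (expandHom M hM) (expandHom_injective M hM) (γ := γ) hFm hF
    (by exact h1) (by exact h2)

theorem derivative_expandHom {M : ℕ} (hM : M ≠ 0) (hM0 : (M : K) = 0) (f : K⟦X⟧) :
    PowerSeries.derivative K (expandHom M hM f) = 0 := by
  ext i
  rw [PowerSeries.coeff_derivative, coeff_expandHom, map_zero]
  split_ifs with h
  · obtain ⟨k, hk⟩ := h
    have : ((i : K) + 1) = 0 := by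
      rw [← Nat.cast_one, ← Nat.cast_add, hk, Nat.cast_mul, hM0, zero_mul]
    rw [this, mul_zero]
  · rw [zero_mul]

/-- Chain rule: when M = 0 in K the series in t^M have zero derivative, so only the derivative in y
contributes. -/
theorem derivative_evalHom {M : ℕ} (hM : M ≠ 0) (hM0 : (M : K) = 0) (γ : K⟦X⟧) (F : K⟦X⟧[X]) :
    PowerSeries.derivative K (evalHom M hM γ F) =
      evalHom M hM γ (Polynomial.derivative F) * PowerSeries.derivative K γ := by
  induction F using Polynomial.induction_on' with
  | add p q hp hq => simp only [map_add, hp, hq, add_mul]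
  | monomial k a =>
    have h1 : ∀ (c : K⟦X⟧) (j : ℕ),
        evalHom M hM γ (Polynomial.monomial j c) = expandHom M hM c * γ ^ j := fun c j => by
      simp [evalHom]
    rw [Polynomial.derivative_monomial, h1, h1, Derivation.leibniz, derivative_expandHom hM hM0,
      smul_zero, add_zero, Derivation.leibniz_pow, map_mul, map_natCast]
    simp only [smul_eq_mul, nsmul_eq_mul]
    ring

theorem exists_expandHom_eq_of_dvd {m : ℕ} (hm : m ≠ 0) {γ : K⟦X⟧}
    (h : ∀ i, PowerSeries.coeff i γ ≠ 0 → m ∣ i) : ∃ γ', expandHom m hm γ' = γ := by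
  refine ⟨PowerSeries.mk fun i => PowerSeries.coeff (m * i) γ, ?_⟩
  ext i
  rw [coeff_expandHom]
  split_ifs with hi
  · rw [PowerSeries.coeff_mk, Nat.mul_div_cancel' hi]
  · by_contra h0
    exact hi (h i (Ne.symm h0))

theorem evalHom_expandHom {m M : ℕ} (hm : m ≠ 0) (hM : M ≠ 0) (γ : K⟦X⟧) (F : K⟦X⟧[X]) :
    evalHom (m * M) (Nat.mul_ne_zero hm hM) (expandHom m hm γ) F =
      expandHom m hm (evalHom M hM γ F) := by
  have : evalHom (m * M) (Nat.mul_ne_zero hm hM) (expandHom m hm γ) =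
      (expandHom m hm).comp (evalHom M hM γ) := by
    apply Polynomial.ringHom_ext
    · intro a; simp [evalHom, expandHom_mul]
    · simp [evalHom]
  exact congrArg (fun φ => φ F) this

theorem rescale_expandHom {M : ℕ} (hM : M ≠ 0) {ζ : K} (hζ : ζ ^ M = 1) (f : K⟦X⟧) :
    PowerSeries.rescale ζ (expandHom M hM f) = expandHom M hM f := by
  ext i
  rw [PowerSeries.coeff_rescale, coeff_expandHom]
  split_ifs with h
  · obtain ⟨k, rfl⟩ := h
    rw [pow_mul, hζ, one_pow, one_mul]
  · rw [mul_zero]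

theorem evalHom_rescale {M : ℕ} (hM : M ≠ 0) {ζ : K} (hζ : ζ ^ M = 1) (γ : K⟦X⟧) (F : K⟦X⟧[X]) :
    evalHom M hM (PowerSeries.rescale ζ γ) F = PowerSeries.rescale ζ (evalHom M hM γ F) := by
  have : evalHom M hM (PowerSeries.rescale ζ γ) = (PowerSeries.rescale ζ).comp (evalHom M hM γ) := by
    apply Polynomial.ringHom_ext
    · intro a; simp [evalHom, rescale_expandHom hM hζ]
    · simp [evalHom]
  exact congrArg (fun φ => φ F) this

/-- With l = k - j, equality forces M | i l for each exponent i, so M / gcd(M, l) divides all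
exponents of γ and must be 1; hence M | l. -/
theorem eq_of_rescale_eq {M : ℕ} (hM : M ≠ 0) {ω : K} (hω : IsPrimitiveRoot ω M) {γ : K⟦X⟧}
    (hγ : ∀ m, m ∣ M → (∀ i, PowerSeries.coeff i γ ≠ 0 → m ∣ i) → m = 1) {j k : ℕ} (hjk : j ≤ k)
    (hk : k < M) (h : PowerSeries.rescale (ω ^ j) γ = PowerSeries.rescale (ω ^ k) γ) : j = k := by
  obtain ⟨l, rfl⟩ := Nat.exists_eq_add_of_le hjk
  have hω0 : ω ≠ 0 := hω.ne_zero hM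
  have h1 : ∀ i, PowerSeries.coeff i γ ≠ 0 → M ∣ i * l := by
    intro i hi
    have h2 := congrArg (PowerSeries.coeff i) h
    rw [PowerSeries.coeff_rescale, PowerSeries.coeff_rescale] at h2
    have h3 := mul_right_cancel₀ hi h2
    rw [pow_add, mul_pow] at h3
    have h4 : (ω ^ l) ^ i = 1 :=
      (mul_left_cancel₀ (pow_ne_zero i (pow_ne_zero j hω0)) (by rw [mul_one]; exact h3)).symm
    rw [← pow_mul, mul_comm] at h4
    exact hω.dvd_of_pow_eq_one _ h4
  have hg : Nat.gcd M l ∣ M := Nat.gcd_dvd_left M l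
  have hg0 : 0 < Nat.gcd M l := Nat.gcd_pos_of_pos_left l (Nat.pos_of_ne_zero hM)
  have h2 := hγ (M / Nat.gcd M l) (Nat.div_dvd_of_dvd hg) fun i hi => by
    refine (Nat.coprime_div_gcd_div_gcd hg0).dvd_of_dvd_mul_right (n := l / Nat.gcd M l) ?_
    obtain ⟨w, hw⟩ := h1 i hi
    refine ⟨w, Nat.eq_of_mul_eq_mul_left hg0 ?_⟩
    have e1 := Nat.mul_div_cancel' hg
    have e2 := Nat.mul_div_cancel' (Nat.gcd_dvd_right M l)
    calc Nat.gcd M l * (i * (l / Nat.gcd M l)) = i * (Nat.gcd M l * (l / Nat.gcd M l)) := by ring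
      _ = M * w := by rw [e2, hw]
      _ = Nat.gcd M l * (M / Nat.gcd M l) * w := by rw [e1]
      _ = _ := by ring
  have h3 : M = Nat.gcd M l := by
    have := Nat.div_mul_cancel hg
    rw [h2, one_mul] at this
    exact this.symm
  have h4 : M ∣ l := h3 ▸ Nat.gcd_dvd_right M l
  rcases Nat.eq_zero_or_pos l with h5 | h5
  · rw [h5, add_zero]
  · exact absurd (Nat.le_of_dvd h5 h4) (by omega)

/-- An irreducible polynomial of degree `d` prime to the characteristic is the minimal polynomial
of a power series in `x ^ (1 / d)`. -/
theorem exists_puiseux [IsAlgClosed K] {F : K⟦X⟧[X]} (hFm : F.Monic) (hF : Irreducible F)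
    (hd : (F.natDegree : K) ≠ 0) :
    ∃ (hn : F.natDegree ≠ 0) (α : K⟦X⟧) (ω : K), IsPrimitiveRoot ω F.natDegree ∧
      F.map (expandHom F.natDegree hn) = conjProd ω F.natDegree α ∧
      ∀ m, m ∣ F.natDegree → (∀ i, PowerSeries.coeff i α ≠ 0 → m ∣ i) → m = 1 := by
  classical
  have hex : ∃ M : ℕ, ∃ (hM : M ≠ 0) (γ : K⟦X⟧), evalHom M hM γ F = 0 :=
    exists_evalHom_eq_zero hFm hd
  obtain ⟨hM, γ, hγ⟩ := Nat.find_spec hex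
  have hmin : ∀ M' < Nat.find hex, ∀ (hM' : M' ≠ 0) (γ' : K⟦X⟧), evalHom M' hM' γ' F ≠ 0 :=
    fun M' h hM' γ' h0 => Nat.find_min hex h ⟨hM', γ', h0⟩
  generalize Nat.find hex = M at hM hγ hmin
  -- Minimality of the ramification index M makes γ primitive: a common factor of M and all
  -- exponents could be divided out.
  have hgcd : ∀ m, m ∣ M → (∀ i, PowerSeries.coeff i γ ≠ 0 → m ∣ i) → m = 1 := by
    rintro m ⟨M', rfl⟩ hm
    have hm0 : m ≠ 0 := left_ne_zero_of_mul hM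
    have hM'0 : M' ≠ 0 := right_ne_zero_of_mul hM
    obtain ⟨γ', rfl⟩ := exists_expandHom_eq_of_dvd hm0 hm
    rw [evalHom_expandHom hm0 hM'0] at hγ
    have h0 : evalHom M' hM'0 γ' F = 0 := expandHom_injective m hm0 (by rw [hγ, map_zero])
    by_contra hm1
    refine hmin M' ?_ hM'0 γ' h0
    have : 2 ≤ m := by omega
    nlinarith [Nat.pos_of_ne_zero hM'0]
  -- If the characteristic divides M, differentiating F(t^M, γ) = 0 gives F_y(γ) γ' = 0. Here F_y(γ)
  -- ≠ 0, because F_y is nonzero of degree less than deg F. So γ' = 0, and the characteristic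
  -- divides all exponents of γ, against primitivity.
  have hMK : (M : K) ≠ 0 := by
    intro hM0
    have h1 := derivative_evalHom hM hM0 γ F
    rw [hγ, map_zero] at h1
    have h2 : evalHom M hM γ (Polynomial.derivative F) ≠ 0 := by
      intro h0
      have h3 := dvd_of_evalHom_eq_zero hFm hF hγ h0
      have h4 : Polynomial.derivative F = 0 := by
        by_contra hne
        exact absurd (Polynomial.degree_le_of_dvd h3 hne)
          (not_le.2 (Polynomial.degree_derivative_lt hFm.ne_zero))
      have h5 := congrArg (fun G => G.coeff (F.natDegree - 1)) h4
      have hd0 : F.natDegree - 1 + 1 = F.natDegree :=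
        Nat.sub_add_cancel (Nat.one_le_iff_ne_zero.2 fun h => hd (by rw [h]; simp))
      simp only [Polynomial.coeff_derivative, Polynomial.coeff_zero] at h5
      rw [hd0, hFm.coeff_natDegree, one_mul] at h5
      have h6 : ((F.natDegree : ℕ) : K⟦X⟧) = 0 := by
        rw [← hd0]; push_cast; exact h5
      rw [← map_natCast (PowerSeries.C (R := K))] at h6
      exact hd ((map_eq_zero _).1 h6)
    have h3 := (mul_eq_zero.1 h1.symm).resolve_left h2
    have h4 : ringChar K = 1 := by
      refine hgcd _ ((ringChar.spec K M).1 hM0) fun i hi => ?_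
      rcases Nat.eq_zero_or_pos i with rfl | hpos
      · exact dvd_zero _
      · obtain ⟨k, rfl⟩ := Nat.exists_eq_add_of_le' hpos
        have h5 := congrArg (PowerSeries.coeff k) h3
        rw [PowerSeries.coeff_derivative, map_zero] at h5
        rw [← ringChar.spec]
        push_cast
        exact (mul_eq_zero.1 h5).resolve_left hi
    exact CharP.ringChar_ne_one h4
  have : NeZero (M : K) := ⟨hMK⟩
  obtain ⟨ω, hω⟩ := HasEnoughRootsOfUnity.exists_primitiveRoot K M
  obtain ⟨φ, hφ, hφd, hφm⟩ := exists_conjProd_eq_map (hn := hM) hω (e := M) (β := γ)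
    (by rw [hω.pow_eq_one, PowerSeries.rescale_one]; rfl)
  have hFφ : F ∣ φ := dvd_of_evalHom_eq_zero hFm hF hγ
    (evalHom_of_map_eq_conjProd (Nat.pos_of_ne_zero hM) hφ)
  -- The M conjugates of γ are distinct by primitivity, and all are roots of F.
  have hle : M ≤ F.natDegree := by
    set Z : Finset K⟦X⟧ := (Finset.range M).image fun j => PowerSeries.rescale (ω ^ j) γ with hZ
    have hcard : Z.card = M := by
      rw [hZ, Finset.card_image_of_injOn, Finset.card_range]
      intro j hj k hk hjk
      have hj' := Finset.mem_range.1 hj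
      have hk' := Finset.mem_range.1 hk
      rcases le_total j k with h | h
      · exact eq_of_rescale_eq hM hω hgcd h hk' hjk
      · exact (eq_of_rescale_eq hM hω hgcd h hj' hjk.symm).symm
    have hmap : (F.map (expandHom M hM)).Monic := hFm.map _
    rw [← hcard, ← hFm.natDegree_map (expandHom M hM)]
    refine Polynomial.card_le_degree_of_subset_roots fun c hc => ?_
    obtain ⟨j, -, rfl⟩ := Finset.mem_image.1 (Finset.mem_val ▸ hc : c ∈ Z)
    rw [Polynomial.mem_roots hmap.ne_zero, Polynomial.IsRoot, ← evalHom_eq_eval_map,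
      evalHom_rescale hM (by rw [← pow_mul, mul_comm, pow_mul, hω.pow_eq_one, one_pow]), hγ,
      map_zero]
  have hφF : φ = F := Polynomial.eq_of_monic_of_dvd_of_natDegree_le hFm hφm hFφ (by rw [hφd]; exact hle)
  subst hφF
  subst hφd
  exact ⟨hM, γ, ω, hω, hφ, hgcd⟩

/-- A monic polynomial of degree prime to the characteristic has an irreducible factor of degree
prime to the characteristic. -/
theorem exists_irreducible_factor {F : K⟦X⟧[X]} (hF : F.Monic) (hd : (F.natDegree : K) ≠ 0) :
    ∃ P : K⟦X⟧[X], P.Monic ∧ Irreducible P ∧ P ∣ F ∧ (P.natDegree : K) ≠ 0 := by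
  induction hdd : F.natDegree using Nat.strong_induction_on generalizing F with
  | _ d ih =>
    subst hdd
    by_cases hirr : Irreducible F
    · exact ⟨F, hF, hirr, dvd_rfl, hd⟩
    have hF1 : F ≠ 1 := by rintro rfl; simp at hd
    rw [hF.irreducible_iff_natDegree] at hirr
    simp only [hF1, ne_eq, not_false_eq_true, true_and] at hirr
    push Not at hirr
    obtain ⟨G, H, hG, hH, hGH, hG0, hH0⟩ := hirr
    have hsum : G.natDegree + H.natDegree = F.natDegree := by rw [← hGH, hG.natDegree_mul hH]
    by_cases hGK : (G.natDegree : K) = 0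
    · have hHK : (H.natDegree : K) ≠ 0 := fun h => hd (by rw [← hsum, Nat.cast_add, hGK, h, add_zero])
      obtain ⟨P, h1, h2, h3, h4⟩ := ih _ (by omega) hH hHK rfl
      exact ⟨P, h1, h2, h3.trans (Dvd.intro_left G hGH), h4⟩
    · obtain ⟨P, h1, h2, h3, h4⟩ := ih _ (by omega) hG hGK rfl
      exact ⟨P, h1, h2, h3.trans (Dvd.intro H hGH), h4⟩

end Puiseux

/-! ### The test -/

section Test

theorem testLoop_of_le_one {F : K⟦X⟧[X]} {N : ℕ} {v : K⟦X⟧[X] → ℕ∞} (hN : N ≤ 1) :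
    testLoop F N v = true := by
  rw [testLoop, dif_neg (not_lt.2 hN)]

theorem testLoop_eq_true_iff {F : K⟦X⟧[X]} {N : ℕ} {v : K⟦X⟧[X] → ℕ∞} (hN : 1 < N) :
    testLoop F N v = true ↔
      (∃ k : ℕ, v F = (k : ℕ∞) ∧
        ((N : ℝ), (k : ℝ)) ∈ newtonPolygon v (approxRoot F N) F) ∧
      IsStraight (newtonPolygon v (approxRoot F N) F) ∧
      1 < (negSlope (newtonPolygon v (approxRoot F N) F)).den ∧
      testLoop F (N / (negSlope (newtonPolygon v (approxRoot F N) F)).den)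
        (nextVal v (approxRoot F N) (negSlope (newtonPolygon v (approxRoot F N) F)).den
          (negSlope (newtonPolygon v (approxRoot F N) F)).num.toNat) = true := by
  rw [testLoop, dif_pos hN]
  dsimp only
  split_ifs with h
  · exact ⟨fun h' => ⟨h.1, h.2.1, h.2.2, h'⟩, fun h' => h'.2.2.2⟩
  · exact ⟨fun h' => absurd h' (by simp), fun h' => absurd ⟨h'.1, h'.2.1, h'.2.2.1⟩ h⟩

variable {F : K⟦X⟧[X]}

theorem natCast_ne_zero_of_dvd {N d : ℕ} (h : N ∣ d) (hd : (d : K) ≠ 0) : (N : K) ≠ 0 := by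
  rintro h0
  obtain ⟨k, rfl⟩ := h
  exact hd (by rw [Nat.cast_mul, h0, zero_mul])

theorem approxRoot_spec (hF : F.Monic) (hd : (F.natDegree : K) ≠ 0) {N e : ℕ}
    (h : F.natDegree = N * e) :
    (approxRoot F N).Monic ∧ (approxRoot F N).natDegree = e ∧ 0 < N ∧ 0 < e := by
  have hd0 : F.natDegree ≠ 0 := fun h => hd (by rw [h]; simp)
  have hN : 0 < N := Nat.pos_of_ne_zero fun h' => hd0 (by rw [h, h', zero_mul])
  have he : 0 < e := Nat.pos_of_ne_zero fun h' => hd0 (by rw [h, h', mul_zero])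
  obtain ⟨h1, h2, -⟩ := isApproxRoot_approxRoot hF
    (natCast_ne_zero_of_dvd (Dvd.intro e h.symm) hd) (Dvd.intro e h.symm)
  exact ⟨h1, by rw [h2, h, Nat.mul_div_cancel_left _ hN], hN, he⟩

/-- The end points of the polygon give q A = q v(F) + N m, so q divides N m while being prime to m.
Hence the division N / q in the loop is exact. -/
theorem den_dvd_of_pass {v : K⟦X⟧[X] → ℕ∞} (hF : F.Monic) (hd : (F.natDegree : K) ≠ 0) {N : ℕ}
    (hN : N ∣ F.natDegree) {k : ℕ}
    (hk : ((N : ℝ), (k : ℝ)) ∈ newtonPolygon v (approxRoot F N) F)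
    (hs : IsStraight (newtonPolygon v (approxRoot F N) F))
    (hq : 1 < (negSlope (newtonPolygon v (approxRoot F N) F)).den) :
    (negSlope (newtonPolygon v (approxRoot F N) F)).den ∣ N := by
  obtain ⟨e, he⟩ := hN
  obtain ⟨hψ, hψe, hN0, he0⟩ := approxRoot_spec hF hd he
  have hzero : ∀ i, N < i → adicCoeff (approxRoot F N) F i = 0 := fun i hi =>
    adicCoeff_eq_zero hψ (by rw [he, hψe]; exact Nat.mul_lt_mul_of_pos_right hi he0)
  obtain ⟨A, -, -, h1, h2, -⟩ := newtonPolygon_of_pass hN0 hzero hk hs hq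
  set μ := negSlope (newtonPolygon v (approxRoot F N) F)
  have hcop : Nat.Coprime μ.den μ.num.toNat := by
    have := μ.reduced
    rw [Nat.coprime_comm]
    convert this using 1
    omega
  refine hcop.dvd_of_dvd_mul_right ?_
  exact (Nat.dvd_add_right (Dvd.intro k rfl)).1 (Dvd.intro A h1)

/-! ### Independence of the coefficient field -/

section BaseChange
variable {L : Type*} [Field L] (f : K →+* L)

theorem map_map_injective :
    Function.Injective (Polynomial.map (PowerSeries.map f) : K⟦X⟧[X] → L⟦X⟧[X]) := by
  apply Polynomial.map_injective
  intro a b hab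
  ext i
  have := congrArg (PowerSeries.coeff i) hab
  rw [PowerSeries.coeff_map, PowerSeries.coeff_map] at this
  exact f.injective this

theorem initialVal_map (G : K⟦X⟧[X]) :
    initialVal (G.map (PowerSeries.map f)) = initialVal G := by
  refine iInf_congr fun i => ?_
  rw [Polynomial.coeff_map]
  refine ENat.eq_of_forall_natCast_le_iff fun m => ?_
  rw [natCast_le_order_iff, natCast_le_order_iff, PowerSeries.X_pow_dvd_iff,
    PowerSeries.X_pow_dvd_iff]
  simp only [PowerSeries.coeff_map, map_eq_zero]

theorem newtonPolygon_map {v : K⟦X⟧[X] → ℕ∞} {w : L⟦X⟧[X] → ℕ∞}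
    (hvw : ∀ G, w (G.map (PowerSeries.map f)) = v G) {ψ : K⟦X⟧[X]} (hψ : ψ.Monic) :
    newtonPolygon w (ψ.map (PowerSeries.map f)) (F.map (PowerSeries.map f)) =
      newtonPolygon v ψ F := by
  have : newtonRegion w (ψ.map (PowerSeries.map f)) (F.map (PowerSeries.map f)) =
      newtonRegion v ψ F := by
    have h0 : ∀ G : K⟦X⟧[X], G.map (PowerSeries.map f) ≠ 0 ↔ G ≠ 0 := fun G => by
      rw [ne_eq, ← Polynomial.map_zero (PowerSeries.map f), (map_map_injective f).eq_iff]
    simp only [newtonRegion, adicCoeff_map _ hψ, ← Polynomial.map_pow, ← Polynomial.map_mul, hvw,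
      h0]
  simp only [newtonPolygon, this]

theorem nextVal_map {v : K⟦X⟧[X] → ℕ∞} {w : L⟦X⟧[X] → ℕ∞}
    (hvw : ∀ G, w (G.map (PowerSeries.map f)) = v G) {ψ : K⟦X⟧[X]} (hψ : ψ.Monic) (q m : ℕ)
    (G : K⟦X⟧[X]) :
    nextVal w (ψ.map (PowerSeries.map f)) q m (G.map (PowerSeries.map f)) = nextVal v ψ q m G := by
  simp only [nextVal, adicCoeff_map _ hψ, ← Polynomial.map_pow, ← Polynomial.map_mul, hvw]

/-- The test does not depend on the field of coefficients. -/
theorem testLoop_map (hF : F.Monic) (hd : (F.natDegree : K) ≠ 0) {N : ℕ} (hN : N ∣ F.natDegree)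
    {v : K⟦X⟧[X] → ℕ∞} {w : L⟦X⟧[X] → ℕ∞} (hvw : ∀ G, w (G.map (PowerSeries.map f)) = v G) :
    testLoop (F.map (PowerSeries.map f)) N w = testLoop F N v := by
  induction N using Nat.strong_induction_on generalizing v w with
  | _ N ih =>
    rcases le_or_gt N 1 with h1 | h1
    · rw [testLoop_of_le_one h1, testLoop_of_le_one h1]
    have hNK := natCast_ne_zero_of_dvd hN hd
    have hψ := (isApproxRoot_approxRoot hF hNK hN).1
    rw [Bool.eq_iff_iff, testLoop_eq_true_iff h1, testLoop_eq_true_iff h1,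
      approxRoot_map f hF hNK hN, newtonPolygon_map f hvw hψ, hvw]
    refine and_congr_right fun ha => and_congr_right fun hb => and_congr_right fun hc => ?_
    obtain ⟨k, -, hk⟩ := ha
    have hq := den_dvd_of_pass hF hd hN hk hb hc
    rw [ih _ (Nat.div_lt_self (by omega) hc) ((Nat.div_dvd_of_dvd hq).trans hN)
      (nextVal_map f hvw hψ _ _)]

end BaseChange

/-! ### The two implications, by induction along the loop -/

section Loop
variable {n : ℕ} {hn : n ≠ 0} {α : K⟦X⟧} {ω : K} {e N' b : ℕ} {v : K⟦X⟧[X] → ℕ∞}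

/-- If the first coefficients of an adic expansion lie on or above a line, and if the sum vanishes
at `α`, then the slope of the line is given by the order of `ψ` at `α`. -/
theorem mul_evalOrd_eq_of_line {ψ : K⟦X⟧[X]} {N q T : ℕ} {c : ℕ → K⟦X⟧[X]} (hN : 0 < N)
    (hq : 0 < q) (hsum : evalHom n hn α (∑ i ∈ Finset.range (N + 1), c i * ψ ^ i) = 0)
    (hcN : evalOrd n hn α (c N) = 0) (hc0 : (q : ℕ∞) * evalOrd n hn α (c 0) = (N * T : ℕ))
    (hle : ∀ i ≤ N, ((N * T : ℕ) : ℕ∞) ≤ q * evalOrd n hn α (c i) + (i * T : ℕ)) :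
    ∃ u : ℕ, evalOrd n hn α ψ = u ∧ q * u = T := by
  have htop : evalOrd n hn α (∑ i ∈ Finset.range (N + 1), c i * ψ ^ i) = ⊤ := by
    rw [evalOrd, hsum, PowerSeries.order_zero]
  have hord : ∀ i, evalOrd n hn α (c i * ψ ^ i) =
      evalOrd n hn α (c i) + (i : ℕ∞) * evalOrd n hn α ψ := fun i => by
    rw [evalOrd_mul, evalOrd_pow]
  have hc0fin : evalOrd n hn α (c 0) ≠ ⊤ := by
    intro h
    rw [h, ENat.mul_top (by exact_mod_cast hq.ne')] at hc0
    exact absurd hc0.symm (ENat.natCast_ne_top _)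
  obtain ⟨a, ha⟩ := ENat.ne_top_iff_exists.1 hc0fin
  have hqa : q * a = N * T := by rw [← ha] at hc0; exact_mod_cast hc0
  -- If ψ had order larger than T / q, the constant term would be the only one of minimal order and
  -- the sum could not vanish.
  have hu_le : ∀ u : ℕ, T < q * u → ¬ ((u : ℕ∞) ≤ evalOrd n hn α ψ) := by
    intro u hu hle'
    have h1 : evalOrd n hn α (∑ i ∈ Finset.range (N + 1), c i * ψ ^ i) =
        evalOrd n hn α (c 0 * ψ ^ 0) := by
      refine evalOrd_sum_eq (Finset.range (N + 1)) (fun i => c i * ψ ^ i) (i := 0) (by simp)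
        (by rw [pow_zero, mul_one]; exact hc0fin) fun i hi hi0 => ?_
      simp only [hord]
      rw [Nat.cast_zero, zero_mul, add_zero, ← ha]
      refine lt_of_lt_of_le ?_ (add_le_add_right (mul_le_mul_right hle' _) _)
      rcases eq_or_ne (evalOrd n hn α (c i)) ⊤ with h | h
      · rw [h, top_add]; exact ENat.natCast_lt_top _
      obtain ⟨y, hy⟩ := ENat.ne_top_iff_exists.1 h
      have h2 := hle i (Nat.lt_succ_iff.1 (Finset.mem_range.1 hi))
      rw [← hy] at h2 ⊢
      have h3 : N * T ≤ q * y + i * T := by exact_mod_cast h2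
      have h4 : a < y + i * u := by
        have : i * T < i * (q * u) := Nat.mul_lt_mul_of_pos_left hu (Nat.pos_of_ne_zero hi0)
        refine lt_of_mul_lt_mul_left (a := q) ?_ (Nat.zero_le q)
        rw [mul_add]
        have : q * (i * u) = i * (q * u) := by ring
        omega
      exact_mod_cast h4
    rw [htop, pow_zero, mul_one] at h1
    exact hc0fin h1.symm
  have hfin : evalOrd n hn α ψ ≠ ⊤ := fun h =>
    hu_le (T + 1) (by nlinarith) (by rw [h]; exact le_top)
  obtain ⟨u, hu⟩ := ENat.ne_top_iff_exists.1 hfin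
  refine ⟨u, hu.symm, le_antisymm (not_lt.1 fun h => hu_le u h hu.le) (not_lt.1 fun hlt => ?_)⟩
  -- If the order of ψ is smaller than T / q, the term of index N alone is minimal, again
  -- contradicting the vanishing.
  have h1 : evalOrd n hn α (∑ i ∈ Finset.range (N + 1), c i * ψ ^ i) =
      evalOrd n hn α (c N * ψ ^ N) := by
    have hNu : evalOrd n hn α (c N * ψ ^ N) = (N * u : ℕ) := by
      rw [hord, hcN, zero_add, ← hu]; push_cast; rfl
    refine evalOrd_sum_eq (Finset.range (N + 1)) (fun i => c i * ψ ^ i) (i := N) (by simp)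
      (by rw [hNu]; exact ENat.natCast_ne_top _) fun i hi hiN => ?_
    have hi' : i < N := lt_of_le_of_ne (Nat.lt_succ_iff.1 (Finset.mem_range.1 hi)) hiN
    simp only [hNu]
    rw [hord, ← hu]
    rcases eq_or_ne (evalOrd n hn α (c i)) ⊤ with h | h
    · rw [h, top_add]; exact ENat.natCast_lt_top _
    obtain ⟨y, hy⟩ := ENat.ne_top_iff_exists.1 h
    have h2 := hle i hi'.le
    rw [← hy] at h2 ⊢
    have h3 : N * T ≤ q * y + i * T := by exact_mod_cast h2
    have h4 : N * u < y + i * u := by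
      obtain ⟨j, rfl⟩ := Nat.exists_eq_add_of_lt hi'
      have : (j + 1) * (q * u) < (j + 1) * T := Nat.mul_lt_mul_of_pos_left hlt (Nat.succ_pos j)
      refine lt_of_mul_lt_mul_left (a := q) ?_ (Nat.zero_le q)
      nlinarith
    exact_mod_cast h4
  rw [htop, hord, hcN, ← hu, zero_add] at h1
  exact absurd h1.symm (by rw [← Nat.cast_mul]; exact ENat.natCast_ne_top _)

theorem IsKey.of_keyPoly {b' R : ℕ} {φ : K⟦X⟧[X]} (h1 : φ.Monic) (h2 : φ.natDegree = e)
    (h3 : shiftVal n hn α b φ = (b + R : ℕ)) (h4 : shiftVal n hn α b' φ = (b' + R : ℕ))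
    (h5 : evalOrd n hn α φ = (b' + R : ℕ)) (h6 : evalOrd n hn (cut b' α) φ = ⊤) :
    IsKey n hn α e b b' R φ :=
  ⟨h1, h2, h3, h4, h5, by rw [h6]; exact ENat.natCast_lt_top _⟩

/-- If the order of `ψ` at `α` is not divisible by `N`, then `ψ` is a key polynomial. -/
theorem IsState.exists_isKey (h : IsState n hn α e N' b v) (hω : IsPrimitiveRoot ω n)
    (hα : ∀ m, m ∣ n → (∀ i, PowerSeries.coeff i α ≠ 0 → m ∣ i) → m = 1)
    {ψ : K⟦X⟧[X]} (hψ : ψ.Monic) (hψe : ψ.natDegree = e) {u : ℕ}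
    (hu : evalOrd n hn α ψ = u) (hNu : ¬ N' ∣ u) :
    ∃ b' R, IsNextExponent α N' b b' ∧ IsKey n hn α e b b' R ψ := by
  obtain ⟨b', hb'⟩ := h.level.exists_next (by rintro rfl; exact hNu (one_dvd u)) hα
  obtain ⟨φ, R, h1, h2, h3, h4, h5, h6, -⟩ := exists_keyPoly hn hω h.level hb'
  have hφ : IsKey n hn α e b b' R φ := IsKey.of_keyPoly h1 h2 h3 h4 h5 h6
  refine ⟨b', R, hb', ?_⟩
  have hδ : (ψ - φ).degree < e := by
    have hψd : ψ.degree = e := by rw [Polynomial.degree_eq_natDegree hψ.ne_zero, hψe]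
    have hφd : φ.degree = e := by rw [Polynomial.degree_eq_natDegree h1.ne_zero, h2]
    rw [← hψd]
    exact Polynomial.degree_sub_lt_left (hψd.trans hφd.symm) hψ.ne_zero
      (hψ.leadingCoeff.trans h1.leadingCoeff.symm)
  -- The order of δ = ψ - φ is a multiple of N' because deg δ < e. It cannot equal b' + R, which is
  -- not one; were it smaller, it would be the order u of ψ, excluded by `hNu`.
  have key := hφ.add h hb'.lt hδ ?_
  · rwa [add_sub_cancel] at key
  by_contra hcon
  have hle := not_lt.1 hcon
  obtain ⟨k, hk⟩ := ENat.ne_top_iff_exists.1 (ne_top_of_le_ne_top (ENat.natCast_ne_top _) hle)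
  have hNk := h.dvd_of_evalOrd_eq hδ hk.symm
  rcases hle.lt_or_eq with hlt | heq
  · refine hNu ?_
    have h7 : evalOrd n hn α ((ψ - φ) + φ) = evalOrd n hn α (ψ - φ) :=
      evalOrd_add_eq_left (by rw [h5]; exact hlt)
    rw [sub_add_cancel, hu, ← hk] at h7
    have : u = k := by exact_mod_cast h7
    rwa [this]
  · rw [← hk] at heq
    have h8 : k = b' + R := by exact_mod_cast heq
    rw [h8] at hNk
    exact hb'.not_dvd ((Nat.dvd_add_left (hφ.dvd_R h)).1 hNk)

theorem coprime_den_toNat {μ : ℚ} (hμ : 0 < μ.num.toNat) : Nat.Coprime μ.den μ.num.toNat := by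
  have := μ.reduced
  rw [Nat.coprime_comm]
  convert this using 1
  omega

/-- If the test returns true, then every Puiseux series of ramification index `n` which is a root
of `F` is such that `deg F` divides `n`. -/
theorem natDegree_dvd_of_testLoop (hω : IsPrimitiveRoot ω n)
    (hα : ∀ m, m ∣ n → (∀ i, PowerSeries.coeff i α ≠ 0 → m ∣ i) → m = 1)
    (hF : F.Monic) (hd : (F.natDegree : K) ≠ 0) (hroot : evalHom n hn α F = 0) {N : ℕ}
    (h : IsState n hn α e N' b v) (hN : F.natDegree = N * e) (htest : testLoop F N v = true) :
    F.natDegree ∣ n := by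
  -- N is the integer of the loop, deg F / e, whereas N' = n / e belongs to the root α; they are not
  -- yet known to agree.
  induction N using Nat.strong_induction_on generalizing e N' b v with
  | _ N ih =>
    obtain ⟨hψ, hψe, hN0, he0⟩ := approxRoot_spec hF hd hN
    rcases le_or_gt N 1 with h1 | h1
    · have : N = 1 := by omega
      rw [hN, this, one_mul, h.level.eq_mul]
      exact Dvd.intro_left N' rfl
    rw [testLoop_eq_true_iff h1] at htest
    obtain ⟨⟨vF, -, hP⟩, hs, hq, hloop⟩ := htest
    set ψ := approxRoot F N with hψdef
    have hzero : ∀ i, N < i → adicCoeff ψ F i = 0 := fun i hi =>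
      adicCoeff_eq_zero hψ (by rw [hN, hψe]; exact Nat.mul_lt_mul_of_pos_right hi he0)
    have hqN := den_dvd_of_pass hF hd (Dvd.intro e hN.symm) hP hs hq
    obtain ⟨A, -, hA, hAq, hm, hle, hvN⟩ := newtonPolygon_of_pass hN0 hzero hP hs hq
    have hcop := coprime_den_toNat hm
    set q := (negSlope (newtonPolygon v ψ F)).den
    set m := (negSlope (newtonPolygon v ψ F)).num.toNat
    have hcN : adicCoeff ψ F N = 1 := adicCoeff_top hψ (by omega) hF (by rw [hψe]; exact hN)
    have hcdeg : ∀ i, (adicCoeff ψ F i).degree < e := fun i => by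
      have := degree_adicCoeff_lt hψ F i
      rwa [Polynomial.degree_eq_natDegree hψ.ne_zero, hψe] at this
    have hN'0 := h.ne_zero
    -- the value of `ψ`
    have hvψ : (N : ℕ∞) * shiftVal n hn α b ψ = (N' * vF : ℕ) := by
      have := h.val (adicCoeff ψ F N * ψ ^ N)
      rw [hvN, hcN, one_mul, shiftVal_pow] at this
      rw [← this]; push_cast; rfl
    have hψfin : shiftVal n hn α b ψ ≠ ⊤ := by
      intro h'
      rw [h', ENat.mul_top (by exact_mod_cast hN0.ne')] at hvψ
      exact absurd hvψ.symm (ENat.natCast_ne_top _)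
    obtain ⟨U, hU⟩ := ENat.ne_top_iff_exists.1 hψfin
    have hNU : N * U = N' * vF := by rw [← hU] at hvψ; exact_mod_cast hvψ
    have hval : ∀ i, (N' : ℕ∞) * v (adicCoeff ψ F i * ψ ^ i) =
        evalOrd n hn α (adicCoeff ψ F i) + (i * U : ℕ) := fun i => by
      rw [h.val, shiftVal_mul, shiftVal_pow, h.low _ (hcdeg i), ← hU]; push_cast; rfl
    -- Rescaled to orders in t, the polygon is the line required by `mul_evalOrd_eq_of_line` with T
    -- = q U + N' m.
    have hT : N * (q * U + N' * m) = q * (N' * A) := by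
      calc N * (q * U + N' * m) = q * (N * U) + N' * (N * m) := by ring
        _ = N' * (q * vF + N * m) := by rw [hNU]; ring
        _ = q * (N' * A) := by rw [← hAq]; ring
    obtain ⟨u, hu, hqu⟩ : ∃ u : ℕ, evalOrd n hn α ψ = u ∧ q * u = q * U + N' * m := by
      refine mul_evalOrd_eq_of_line (c := adicCoeff ψ F) hN0 (by omega) ?_ ?_ ?_ fun i hi => ?_
      · rw [← eq_sum_adicCoeff hψ (by rw [hN, hψe]; nlinarith)]
        exact hroot
      · rw [hcN, evalOrd, map_one, PowerSeries.order_one]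
      · have := hval 0
        rw [hA, zero_mul, Nat.cast_zero, add_zero] at this
        rw [← this, hT]; push_cast; rfl
      · rcases eq_or_ne (evalOrd n hn α (adicCoeff ψ F i)) ⊤ with htop | htop
        · rw [htop, ENat.mul_top (by exact_mod_cast (show q ≠ 0 by omega)), top_add]
          exact le_top
        have hvi := hval i
        have hvfin : v (adicCoeff ψ F i * ψ ^ i) ≠ ⊤ := by
          intro h'
          rw [h', ENat.mul_top (by exact_mod_cast hN'0)] at hvi
          obtain ⟨y, hy⟩ := ENat.ne_top_iff_exists.1 htop
          rw [← hy, ← Nat.cast_add] at hvi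
          exact absurd hvi.symm (ENat.natCast_ne_top _)
        obtain ⟨k, hk⟩ := ENat.ne_top_iff_exists.1 hvfin
        obtain ⟨y, hy⟩ := ENat.ne_top_iff_exists.1 htop
        have hi0 : adicCoeff ψ F i ≠ 0 := fun h' => htop (by rw [h', evalOrd_zero])
        have h2 := hle i k hi0 hk.symm
        rw [← hk, ← hy] at hvi
        have h3 : N' * k = y + i * U := by exact_mod_cast hvi
        rw [← hy]
        have h4 : N * (q * U + N' * m) ≤ q * y + i * (q * U + N' * m) := by
          rw [hT]
          calc q * (N' * A) = N' * (q * A) := by ring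
            _ ≤ N' * (q * k + i * m) := Nat.mul_le_mul_left _ h2
            _ = q * (N' * k) + i * (N' * m) := by ring
            _ = q * y + i * (q * U + N' * m) := by rw [h3]; ring
        exact_mod_cast h4
    -- Both u and U being multiples of N' would give q | m, impossible for coprime q > 1 and m.
    have hNu : ¬ N' ∣ u := by
      rintro ⟨w, rfl⟩
      obtain ⟨w', rfl⟩ := h.dvd_of_shiftVal_eq hU.symm
      have h2 : N' * (q * w) = N' * (q * w' + m) := by linear_combination hqu
      have h3 := Nat.eq_of_mul_eq_mul_left (Nat.pos_of_ne_zero hN'0) h2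
      have h4 : q ∣ m := (Nat.dvd_add_right (Dvd.intro w' rfl)).1 (Dvd.intro w h3)
      have : q = 1 := hcop.eq_one_of_dvd h4
      omega
    obtain ⟨b', R, hb', hkey⟩ := h.exists_isKey hω hα hψ hψe hu hNu
    have hUb : U = b + R := by
      have := hU.trans hkey.shiftVal_left; exact_mod_cast this
    have hub : u = b' + R := by
      have := hu.symm.trans hkey.evalOrd_self; exact_mod_cast this
    have hqb : q * b' = q * b + N' * m := by
      rw [hUb, hub] at hqu
      nlinarith
    -- From q (b' - b) = N' m and the coprimality of q and m.
    obtain ⟨g, hg⟩ : q ∣ N' := hcop.dvd_of_dvd_mul_right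
      ((Nat.dvd_add_right (Dvd.intro b rfl)).1 (Dvd.intro b' hqb))
    have hbg : b' = b + g * m := by
      refine Nat.eq_of_mul_eq_mul_left (show 0 < q by omega) ?_
      rw [hqb, hg]; ring
    have hnext := h.next hb' hkey (g := g) (q := q) (m := m) (by rw [hg, mul_comm]) hbg hcop
    obtain ⟨N₁, hN₁⟩ := hqN
    have hdivN : N / q = N₁ := by rw [hN₁, Nat.mul_div_cancel_left _ (show 0 < q by omega)]
    rw [hdivN] at hloop
    exact ih N₁ (hdivN ▸ Nat.div_lt_self hN0 hq) hnext (by rw [hN, hN₁]; ring) hloop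

/-- The test succeeds on the minimal polynomial of a Puiseux series. -/
theorem testLoop_eq_true (hω : IsPrimitiveRoot ω n)
    (hα : ∀ m, m ∣ n → (∀ i, PowerSeries.coeff i α ≠ 0 → m ∣ i) → m = 1)
    (hF : F.Monic) (hd : (F.natDegree : K) ≠ 0) (hFn : F.natDegree = n)
    (hconj : F.map (expandHom n hn) = conjProd ω n α) {N : ℕ}
    (h : IsState n hn α e N b v) : testLoop F N v = true := by
  induction N using Nat.strong_induction_on generalizing e b v with
  | _ N ih =>
    rcases le_or_gt N 1 with h1 | h1
    · exact testLoop_of_le_one h1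
    have hN : F.natDegree = N * e := hFn.trans h.level.eq_mul
    have hN0 : 0 < N := by omega
    have he0 := h.pos
    have hNF : N ∣ F.natDegree := Dvd.intro e hN.symm
    have hNK := natCast_ne_zero_of_dvd hNF hd
    obtain ⟨b', hb'⟩ := h.level.exists_next (by omega) hα
    obtain ⟨φ, R, k1, k2, k3, k4, k5, k6, hFval⟩ := exists_keyPoly hn hω h.level hb'
    obtain ⟨hF1, hF2, hF3⟩ := hFval F hconj
    -- The valuation of F at b' is the minimum of its ψ-adic terms, so each of them lies on or above
    -- the line.
    have hline : ∀ ψ, IsKey n hn α e b b' R ψ → ∀ i, ((N * (b' + R) : ℕ) : ℕ∞) ≤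
        evalOrd n hn α (adicCoeff ψ F i) + (i : ℕ∞) * (b' + R : ℕ) := fun ψ hψ i => by
      rw [← hF2, hψ.shiftVal_eq_iInf h hb'.lt]
      exact iInf_le _ i
    obtain ⟨ψ, hψF, hψ⟩ := exists_isApproxRoot_of_tschirnhausen hF hNK hN
      (IsKey n hn α e b b' R) (fun ψ _ _ hψ => by
        refine hψ.add h hb'.lt
          ((degree_C_mul_le _ _).trans_lt (hψ.degree_adicCoeff_lt F _)) ?_
        rw [evalOrd_mul]
        refine lt_of_lt_of_le ?_ le_add_self
        -- At index N - 1 the line says that c_(N-1) has order at least b' + R. Equality is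
        -- impossible: the order is a multiple of N, as is R, but b' is not. So `IsKey.add` applies
        -- to the correction.
        have h2 := hline ψ hψ (N - 1)
        refine lt_of_not_ge fun hle => ?_
        obtain ⟨y, hy⟩ := ENat.ne_top_iff_exists.1
          (ne_top_of_le_ne_top (ENat.natCast_ne_top _) hle)
        obtain ⟨w, rfl⟩ := h.dvd_of_evalOrd_eq (hψ.degree_adicCoeff_lt F _) hy.symm
        rw [← hy] at h2 hle
        have h3 : N * (b' + R) ≤ N * w + (N - 1) * (b' + R) := by exact_mod_cast h2
        have h4 : N * w ≤ b' + R := by exact_mod_cast hle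
        have h5 : b' + R = N * w := by
          obtain ⟨j, rfl⟩ := Nat.exists_eq_add_of_lt hN0
          rw [zero_add, Nat.add_sub_cancel] at h3
          nlinarith
        exact hb'.not_dvd ((Nat.dvd_add_left (hψ.dvd_R h)).1 (Dvd.intro w h5.symm)))
      k1 k2 (IsKey.of_keyPoly k1 k2 k3 k4 k5 k6)
    have hroot : approxRoot F N = ψ := hψF.eq_approxRoot hF hNK hNF
    have hzero : ∀ i, N < i → adicCoeff ψ F i = 0 := fun i hi =>
      adicCoeff_eq_zero hψ.monic
        (by rw [hN, hψ.natDegree]; exact Nat.mul_lt_mul_of_pos_right hi he0)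
    have hcN : adicCoeff ψ F N = 1 :=
      adicCoeff_top hψ.monic (by rw [hψ.natDegree]; exact he0) hF (by rw [hψ.natDegree]; exact hN)
    have hval : ∀ i, (N : ℕ∞) * v (adicCoeff ψ F i * ψ ^ i) =
        evalOrd n hn α (adicCoeff ψ F i) + (i : ℕ∞) * (b + R : ℕ) := fun i => by
      rw [h.val, hψ.shiftVal_adic h]
    have hcancel : ∀ (x : ℕ∞) (y : ℕ), (N : ℕ∞) * x = (N * y : ℕ) → x = y := by
      intro x y hxy
      have hx : x ≠ ⊤ := by
        rintro rfl
        rw [ENat.mul_top (by exact_mod_cast hN0.ne')] at hxy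
        exact absurd hxy.symm (ENat.natCast_ne_top _)
      obtain ⟨z, rfl⟩ := ENat.ne_top_iff_exists.1 hx
      have : N * z = N * y := by exact_mod_cast hxy
      exact_mod_cast Nat.eq_of_mul_eq_mul_left hN0 this
    -- the constant coefficient
    have hc0 : evalOrd n hn α (adicCoeff ψ F 0) = (N * (b' + R) : ℕ) := by
      -- If c_0 had larger order, then at the truncated series every term of the expansion would
      -- exceed N (b' + R), the others because ψ does better than b' + R there. This contradicts the
      -- upper bound `hF3`.
      refine le_antisymm (not_lt.1 fun hlt => ?_) (by simpa using hline ψ hψ 0)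
      refine absurd hF3 (not_le.2 ?_)
      have hexp := eq_sum_adicCoeff (G := F) hψ.monic (M := N + 1)
        (by rw [hN, hψ.natDegree]; nlinarith)
      rw [hexp]
      refine lt_evalOrd_sum _ _ (ENat.natCast_ne_top _) fun i _ => ?_
      rw [evalOrd_mul, evalOrd_pow, h.evalOrd_cut hb'.lt (hψ.degree_adicCoeff_lt F i)]
      rcases Nat.eq_zero_or_pos i with rfl | hi
      · simpa using hlt
      rcases eq_or_ne (evalOrd n hn α (adicCoeff ψ F i)) ⊤ with htop | htop
      · rw [htop, top_add]; exact ENat.natCast_lt_top _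
      refine (hline ψ hψ i).trans_lt ((ENat.add_lt_add_iff_left htop).2 ?_)
      exact (ENat.mul_right_strictMono (by exact_mod_cast hi.ne') (ENat.natCast_ne_top i))
        hψ.lt_evalOrd_cut
    have hA : v (adicCoeff ψ F 0 * ψ ^ 0) = (b' + R : ℕ) := by
      apply hcancel
      rw [hval, hc0]; simp
    have hB : v (adicCoeff ψ F N * ψ ^ N) = (b + R : ℕ) := by
      apply hcancel
      rw [hval, hcN, evalOrd, map_one, PowerSeries.order_one, zero_add]; push_cast; rfl
    have hvF : v F = (b + R : ℕ) := by
      apply hcancel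
      rw [h.val, hF1]
    have hA0 : adicCoeff ψ F 0 ≠ 0 := fun h' => by
      rw [h', evalOrd_zero] at hc0
      exact absurd hc0.symm (ENat.natCast_ne_top _)
    have hseg := newtonPolygon_eq_segment (v := v) (ψ := ψ) (F := F) hN0
      (Nat.add_lt_add_right hb'.lt R) hzero hA0 hA (by rw [hcN]; exact one_ne_zero) hB
      (fun i k _ hk => by
        have h2 := hval i
        have h3 := hline ψ hψ i
        rw [hk] at h2
        have hfin : evalOrd n hn α (adicCoeff ψ F i) ≠ ⊤ := by
          intro h'
          rw [h', top_add, ← Nat.cast_mul] at h2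
          exact absurd h2 (ENat.natCast_ne_top _)
        obtain ⟨y, hy⟩ := ENat.ne_top_iff_exists.1 hfin
        rw [← hy] at h2 h3
        have h4 : N * k = y + i * (b + R) := by exact_mod_cast h2
        have h5 : N * (b' + R) ≤ y + i * (b' + R) := by exact_mod_cast h3
        rw [h4]; omega)
    have hslope : negSlope (newtonPolygon v ψ F) = (((b' + R : ℕ) : ℚ) - (b + R : ℕ)) / N := by
      rw [hseg, negSlope_segment hN0]
    rw [testLoop_eq_true_iff h1, hroot]
    set μ := negSlope (newtonPolygon v ψ F) with hμ
    have hblt : (b : ℚ) < b' := by exact_mod_cast hb'.lt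
    have hNQ : (0 : ℚ) < N := by exact_mod_cast hN0
    have hμpos : 0 < μ := by
      rw [hslope]
      push_cast
      exact div_pos (by linarith) hNQ
    have hnum : 0 < μ.num := Rat.num_pos.2 hμpos
    have hm : 0 < μ.num.toNat := by omega
    have hcop := coprime_den_toNat hm
    have hrel : μ.num.toNat * N + μ.den * b = μ.den * b' := by
      have e1 : ((μ.num.toNat : ℕ) : ℚ) = μ * μ.den := by
        have : ((μ.num.toNat : ℕ) : ℤ) = μ.num := Int.toNat_of_nonneg hnum.le
        rw [Rat.mul_den_eq_num, ← this]; rfl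
      have e2 : μ * N = b' - b := by
        rw [hslope]; push_cast; field_simp; ring
      have : ((μ.num.toNat * N + μ.den * b : ℕ) : ℚ) = (μ.den * b' : ℕ) := by
        push_cast
        rw [e1]
        linear_combination (μ.den : ℚ) * e2
      exact_mod_cast this
    obtain ⟨g, hg⟩ : μ.den ∣ N := hcop.dvd_of_dvd_mul_left
      ((Nat.dvd_add_left (Dvd.intro b rfl)).1 (Dvd.intro b' hrel.symm))
    have hden := μ.den_pos
    have hbg : b' = b + g * μ.num.toNat := by
      refine Nat.eq_of_mul_eq_mul_left hden ?_
      rw [← hrel]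
      conv_lhs => rw [hg]
      ring
    -- For q = 1 one has g = N, and b' = b + N m would be a multiple of N.
    have hq1 : 1 < μ.den := by
      refine lt_of_le_of_ne hden fun h2 => hb'.not_dvd ?_
      rw [← h2, one_mul] at hg
      rw [hbg, ← hg]
      exact Nat.dvd_add h.level.dvd (Dvd.intro _ rfl)
    have hdivN : N / μ.den = g := by
      conv_lhs => rw [hg]
      rw [Nat.mul_div_cancel_left _ hden]
    refine ⟨⟨b + R, hvF, ?_⟩, ?_, hq1, ?_⟩
    · rw [hseg]; exact right_mem_segment ℝ _ _
    · exact Or.inr ⟨_, _, hseg⟩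
    · rw [hdivN]
      exact ih g (hdivN ▸ Nat.div_lt_self hN0 hq1)
        (h.next hb' hψ (by rw [mul_comm]; exact hg) hbg hcop)

end Loop

/-- Abhyankar's test over an algebraically closed field. -/
theorem abhyankarTest_eq_true_iff [IsAlgClosed K] (hF : F.Monic) (hd : (F.natDegree : K) ≠ 0) :
    abhyankarTest F = true ↔ Irreducible F := by
  constructor
  · intro htest
    -- Only a factor of degree prime to the characteristic is sure to have a Puiseux root of the
    -- required form.
    obtain ⟨P, hP, hPirr, hPF, hPd⟩ := exists_irreducible_factor hF hd
    obtain ⟨hn, α, ω, hω, hconj, hα⟩ := exists_puiseux hP hPirr hPd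
    have hroot : evalHom P.natDegree hn α F = 0 := by
      obtain ⟨Q, rfl⟩ := hPF
      rw [map_mul, evalHom_of_map_eq_conjProd (Nat.pos_of_ne_zero hn) hconj, zero_mul]
    have hdvd := natDegree_dvd_of_testLoop hω hα hF hd hroot (IsState.zero _ hn α)
      (mul_one _).symm htest
    have : F = P := Polynomial.eq_of_monic_of_dvd_of_natDegree_le hP hF hPF
      (Nat.le_of_dvd (Nat.pos_of_ne_zero hn) hdvd)
    rwa [this]
  · intro hirr
    obtain ⟨hn, α, ω, hω, hconj, hα⟩ := exists_puiseux hF hirr hd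
    exact testLoop_eq_true hω hα hF hd rfl hconj (IsState.zero _ hn α)

theorem abhyankarTest_map {L : Type*} [Field L] (f : K →+* L) (hF : F.Monic)
    (hd : (F.natDegree : K) ≠ 0) :
    abhyankarTest (F.map (PowerSeries.map f)) = abhyankarTest F := by
  rw [abhyankarTest, abhyankarTest, hF.natDegree_map]
  exact testLoop_map f hF hd dvd_rfl (initialVal_map f)

end Test

end Abhyankar

end

theorem mainTheorem6 {K : Type*} [Field K] (F : K⟦X⟧[X]) (hmonic : F.Monic)
    (hweierstrass : ∀ i < F.natDegree, PowerSeries.constantCoeff (F.coeff i) = 0)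
    (hchar : ¬ ringChar K ∣ F.natDegree) :
    Abhyankar.abhyankarTest F = true ↔
      Irreducible (F.map (PowerSeries.map (algebraMap K (AlgebraicClosure K)))) := by
  have hd : (F.natDegree : K) ≠ 0 := fun h => hchar ((ringChar.spec K _).1 h)
  rw [← Abhyankar.abhyankarTest_map (algebraMap K (AlgebraicClosure K)) hmonic hd]
  refine Abhyankar.abhyankarTest_eq_true_iff (hmonic.map _) ?_
  rw [hmonic.natDegree_map, ← map_natCast (algebraMap K (AlgebraicClosure K))]
  exact fun h => hd ((map_eq_zero _).1 h)
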